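/- Let $N\ge 2$ be an integer. Let $\mathbb Y_N$ be the set of integer partitions all of whose hook lengths are strictly less than $N$, ordered by inclusion of Young diagrams, and let $\operatorname{Hasse}(\mathbb Y_N)$ be its undirected Hasse graph, in which $\lambda$ and $\mu$ are adjacent if and only if one of them covers the other (that is, arises from the other by adding one box). Give this connected graph its graph metric, all edges having length $1$, and let $X_N$ be the set of its pendant vertices (those with exactly one neighbour), with the induced metric $d$. For a finite metric space $(X,d)$ put $$\Delta(X)=\{f\in\mathbb R^X\mid f(x)+f(y)\ge d(x,y)\ \text{for all }x,y\in X\},$$ and let the injective hull be $$\operatorname{E}(X)=\{f\in\Delta(X)\mid \text{for every }x\in X\text{ there is }y\in X\text{ with }f(x)+f(y)=d(x,y)\},$$ with the supremum metric. It is the union of the nonempty bounded faces of the polyhedron $\Delta(X)$, and these are by definition the faces of the polyhedral complex $\operatorname{E}(X)$. Its $1$-skeleton is the union of its faces of dimension at most $1$. Then $X_N$ has exactly $N$ points, namely the empty partition and the rectangular partitions $(j^{N-j})$, $j=1,\dots,N-1$, and the $1$-skeleton of $\operatorname{E}(X_N)$ is a geometric realization of $\operatorname{Hasse}(\mathbb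 Y_N)$ with edges of length $1$. That is, there is an injective map $p:\mathbb Y_N\to\mathbb R^{X_N}$ such that 1. the $0$-dimensional faces of $\operatorname{E}(X_N)$ are exactly the sets $\{p(\lambda)\}$, $\lambda\in\mathbb Y_N$; 2. the $1$-dimensional faces of $\operatorname{E}(X_N)$ are exactly the segments $[p(\lambda),p(\mu)]$ with $\lambda$ and $\mu$ adjacent in $\operatorname{Hasse}(\mathbb Y_N)$, and the $1$-skeleton is the union of these points and segments; 3. such a segment contains no point $p(\nu)$ other than its endpoints, and two different such segments meet at most in a common endpoint; 4. $\|p(\lambda)-p(\mu)\|_\infty=1$ whenever $\lambda$ and $\mu$ are adjacent. -/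

import Mathlib

namespace YoungHull

/-! ### Partitions with bounded hook lengths and their Hasse graph -/

/-- Hook length of the cell `(i, j)` (row `i`, column `j`) of a Young diagram:
arm length plus leg length plus one. -/
def hookLength (μ : YoungDiagram) (i j : ℕ) : ℕ :=
  (μ.rowLen i - (j + 1)) + (μ.colLen j - (i + 1)) + 1

/-- `𝕐_N`: the partitions (Young diagrams) all of whose hook lengths are strictly less than `N`.
As a subtype it carries the order of Young's lattice, that is, inclusion of diagrams. -/
abbrev YN (N : ℕ) : Type :=
  {μ : YoungDiagram // ∀ i j : ℕ, (i, j) ∈ μ → hookLength μ i j < N}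

/-- The undirected Hasse graph of `𝕐_N`. -/
abbrev hasseYN (N : ℕ) : SimpleGraph (YN N) := SimpleGraph.hasse (YN N)

theorem lt_of_mem_YN {N : ℕ} (μ : YN N) {c : ℕ × ℕ} (hc : c ∈ μ.1) : c.1 < N ∧ c.2 < N := by
  obtain ⟨i, j⟩ := c
  have h0 : (0, 0) ∈ μ.1 := μ.1.up_left_mem (Nat.zero_le _) (Nat.zero_le _) hc
  have hr : (0, j) ∈ μ.1 := μ.1.up_left_mem (Nat.zero_le _) le_rfl hc
  have hl : (i, 0) ∈ μ.1 := μ.1.up_left_mem le_rfl (Nat.zero_le _) hc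
  have h := μ.2 0 0 h0
  rw [YoungDiagram.mem_iff_lt_rowLen] at hr
  rw [YoungDiagram.mem_iff_lt_colLen] at hl
  unfold hookLength at h
  simp only
  omega

instance finite_YN (N : ℕ) : Finite (YN N) := by
  have hinj : Function.Injective (fun μ : YN N =>
      (⟨μ.1.cells, by
        intro c hc
        have := lt_of_mem_YN μ ((YoungDiagram.mem_cells c).1 hc)
        simpa using this⟩ :
        {s : Finset (ℕ × ℕ) // s ⊆ Finset.range N ×ˢ Finset.range N})) := by
    intro μ ν h
    exact Subtype.ext (YoungDiagram.ext (congrArg Subtype.val h))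
  have hfin : Finite {s : Finset (ℕ × ℕ) // s ⊆ Finset.range N ×ˢ Finset.range N} :=
    Finite.of_equiv {s // s ∈ (Finset.range N ×ˢ Finset.range N).powerset}
      (Equiv.subtypeEquivRight fun _ => Finset.mem_powerset)
  exact Finite.of_injective _ hinj

/-- The Hasse graph is connected, so that its graph distance is a metric. -/
theorem connected_hasseYN {N : ℕ} : (hasseYN N).Connected := by
  let b : YN N := ⟨⊥, fun i j h => absurd h (YoungDiagram.notMem_bot _)⟩
  have hb : ∀ μ : YN N, b ≤ μ := fun μ => (bot_le : (⊥ : YoungDiagram) ≤ μ.1)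
  have key : ∀ μ : YN N, (hasseYN N).Reachable b μ := by
    intro μ
    induction μ using WellFoundedLT.induction with
    | ind μ ih =>
      rcases (hb μ).eq_or_lt with h | h
      · rw [← h]
      · obtain ⟨ν, -, hν⟩ := exists_le_covBy_of_lt h
        exact (ih ν hν.lt).trans (SimpleGraph.Adj.reachable (Or.inl hν))
  have : Nonempty (YN N) := ⟨b⟩
  exact ⟨fun μ ν => (key μ).symm.trans (key ν)⟩

/-! ### The boundary `X_N` with its metric -/

/-- The pendant vertices of a graph: those with exactly one neighbour. -/
def pendantVertices {V : Type*} (G : SimpleGraph V) : Set V :=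
  {v | ∃! w, G.Adj v w}

/-- `X_N`: the set of pendant vertices of the Hasse graph of `𝕐_N`. -/
abbrev XN (N : ℕ) : Type := pendantVertices (hasseYN N)

noncomputable instance fintype_XN (N : ℕ) : Fintype (XN N) := Fintype.ofFinite _

/-- The metric of `X_N`, induced from the graph metric of the Hasse graph
(all edges have length one). -/
noncomputable def dX (N : ℕ) (x y : XN N) : ℝ := ((hasseYN N).dist x.1 y.1 : ℝ)

/-- The rectangular diagram with `r` rows of length `c`, that is, the partition `(c^r)`. -/
def rect (r c : ℕ) : YoungDiagram where
  cells := Finset.range r ×ˢ Finset.range c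
  isLowerSet := by
    rintro ⟨a, b⟩ ⟨a', b'⟩ hab h
    rw [Prod.mk_le_mk] at hab
    simp only [Finset.coe_product, Finset.coe_range, Set.mem_prod, Set.mem_Iio] at h ⊢
    omega

/-! ### The injective hull of a finite metric space, and its faces

Here `X` is a finite set and `d` its distance function. -/

section Hull

variable {X : Type*}

/-- The polyhedron `Δ(X) = {f | f x + f y ≥ d x y for all x, y}`. -/
def polyhedron (d : X → X → ℝ) : Set (X → ℝ) :=
  {f | ∀ x y, d x y ≤ f x + f y}

/-- The injective hull `E(X)`: those `f ∈ Δ(X)` such that for every `x` there is some `y` with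
`f x + f y = d x y`. Its metric is the supremum metric of `X → ℝ`. -/
def injHull (d : X → X → ℝ) : Set (X → ℝ) :=
  {f | f ∈ polyhedron d ∧ ∀ x, ∃ y, f x + f y = d x y}

/-- The faces of the polyhedral complex `E(X)`: the nonempty bounded faces of the polyhedron
`Δ(X)`, a face of a polyhedron being the set where some linear functional attains its maximum.
See `sUnion_hullFaces`: their union is `injHull d`. -/
def hullFaces (d : X → X → ℝ) : Set (Set (X → ℝ)) :=
  {F | F.Nonempty ∧ IsExposed ℝ (polyhedron d) F ∧ Bornology.IsBounded F}

/-- The faces of `E(X)` of dimension `k`. -/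
def hullFacesOfDim (d : X → X → ℝ) (k : ℕ) : Set (Set (X → ℝ)) :=
  {F | F ∈ hullFaces d ∧ Module.finrank ℝ (vectorSpan ℝ F) = k}

/-- The `1`-skeleton of `E(X)`: the union of its faces of dimension at most `1`. -/
def oneSkeleton (d : X → X → ℝ) : Set (X → ℝ) :=
  ⋃₀ {F | F ∈ hullFaces d ∧ Module.finrank ℝ (vectorSpan ℝ F) ≤ 1}

/-- The bounded faces of `Δ(X)` cover exactly `E(X)`. -/
theorem sUnion_hullFaces [Finite X] (d : X → X → ℝ) (hd : ∀ x y, d x y = d y x) :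
    ⋃₀ hullFaces d = injHull d := by
  have := Fintype.ofFinite X
  ext f
  constructor
  · rintro ⟨F, ⟨hne, hexp, hbd⟩, hfF⟩
    obtain ⟨l, rfl⟩ := hexp hne
    obtain ⟨hf, hmax⟩ := hfF
    refine ⟨hf, ?_⟩
    by_contra! hcon
    obtain ⟨x, hx⟩ := hcon
    have hlt : ∀ y, d x y < f x + f y := fun y => lt_of_le_of_ne (hf x y) (hx y).symm
    classical
    have hup : ∀ t : ℝ, 0 ≤ t → f + t • Pi.single x (1 : ℝ) ∈ polyhedron d := by
      intro t ht a b
      have h1 : ∀ c, 0 ≤ t * (Pi.single x (1 : ℝ) : X → ℝ) c := by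
        intro c
        by_cases hc : c = x
        · subst hc; simpa using ht
        · simp [hc]
      have := hf a b
      have := h1 a
      have := h1 b
      simp only [Pi.add_apply, Pi.smul_apply, smul_eq_mul]
      linarith
    obtain ⟨ε, hε, hεd⟩ : ∃ ε : ℝ, 0 < ε ∧ ∀ y, d x y + 2 * ε ≤ f x + f y := by
      have : Nonempty X := ⟨x⟩
      obtain ⟨y₀, hy₀⟩ := Finite.exists_min (fun y => f x + f y - d x y)
      refine ⟨(f x + f y₀ - d x y₀) / 2, by linarith [hlt y₀], fun y => ?_⟩
      linarith [hy₀ y]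
    have hdn : f + (-ε) • Pi.single x (1 : ℝ) ∈ polyhedron d := by
      intro a b
      simp only [Pi.add_apply, Pi.smul_apply, smul_eq_mul]
      by_cases ha : a = x
      · subst ha
        have := hεd b
        by_cases hb : b = a
        · subst hb; simp only [Pi.single_eq_same]; linarith
        · simp only [Pi.single_eq_same, Pi.single_eq_of_ne hb]; linarith
      · by_cases hb : b = x
        · subst hb
          have := hεd a
          rw [hd b a] at this
          simp only [Pi.single_eq_same, Pi.single_eq_of_ne ha]; linarith
        · simp only [Pi.single_eq_of_ne ha, Pi.single_eq_of_ne hb]; linarith [hf a b]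
    have hl0 : l (Pi.single x (1 : ℝ)) = 0 := by
      have h1 := hmax _ (hup 1 zero_le_one)
      have h2 := hmax _ hdn
      simp only [map_add, map_smul, smul_eq_mul] at h1 h2
      nlinarith
    obtain ⟨C, hC⟩ := hbd.exists_norm_le
    have hmem : f + (C + ‖f‖ + 1) • Pi.single x (1 : ℝ) ∈
        {g ∈ polyhedron d | ∀ y ∈ polyhedron d, l y ≤ l g} := by
      refine ⟨hup _ ?_, fun g hg => ?_⟩
      · have := hC f ⟨hf, hmax⟩
        have := norm_nonneg f
        linarith
      · simpa [hl0] using hmax g hg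
    have h3 := (norm_le_pi_norm _ x).trans (hC _ hmem)
    have h4 := norm_le_pi_norm f x
    simp only [Pi.add_apply, Pi.smul_apply, smul_eq_mul, Pi.single_eq_same, mul_one,
      Real.norm_eq_abs] at h3 h4
    have h5 := neg_abs_le (f x)
    have h6 := le_abs_self (f x + (C + ‖f‖ + 1))
    linarith
  · rintro ⟨hf, htight⟩
    choose φ hφ using htight
    let l : StrongDual ℝ (X → ℝ) :=
      -∑ x, (ContinuousLinearMap.proj (R := ℝ) (φ := fun _ : X => ℝ) x
        + ContinuousLinearMap.proj (R := ℝ) (φ := fun _ : X => ℝ) (φ x))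
    have hl : ∀ g, l g = -∑ x, (g x + g (φ x)) := by
      intro g
      simp [l]
    have hlf : ∀ g ∈ polyhedron d, l g ≤ l f := by
      intro g hg
      rw [hl, hl, neg_le_neg_iff]
      exact Finset.sum_le_sum fun x _ => by rw [hφ]; exact hg x _
    refine ⟨{g ∈ polyhedron d | ∀ y ∈ polyhedron d, l y ≤ l g}, ⟨⟨f, hf, hlf⟩, fun _ => ⟨l, rfl⟩, ?_⟩,
      hf, hlf⟩
    have htg : ∀ g ∈ {g ∈ polyhedron d | ∀ y ∈ polyhedron d, l y ≤ l g}, ∀ x,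
        g x + g (φ x) = d x (φ x) := by
      rintro g ⟨hg, hgm⟩ x
      have h1 : ∑ x, (g x + g (φ x)) ≤ ∑ x, (f x + f (φ x)) := by
        have := hgm f hf
        rwa [hl, hl, neg_le_neg_iff] at this
      have h2 : ∀ x ∈ Finset.univ, f x + f (φ x) ≤ g x + g (φ x) := fun x _ => by
        rw [hφ]; exact hg x _
      have h3 := (Finset.sum_eq_sum_iff_of_le h2).1
        (le_antisymm (Finset.sum_le_sum h2) h1) x (Finset.mem_univ x)
      rw [← h3, hφ]
    rw [← Bornology.forall_isBounded_image_eval_iff]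
    intro x
    refine (Metric.isBounded_Icc (d x x / 2) (d x (φ x) - d (φ x) (φ x) / 2)).subset ?_
    rintro _ ⟨g, hg, rfl⟩
    have h1 := htg g hg x
    have h2 := hg.1 x x
    have h3 := hg.1 (φ x) (φ x)
    simp only [Function.eval, Set.mem_Icc]
    constructor <;> linarith

end Hull

/-! ### Geometric realizations of graphs -/

/-- `S` is a geometric realization of the graph `G` in a real vector space, with `p v` the point
that represents the vertex `v` and the segment from `p a` to `p b` representing the edge `ab`:
distinct vertices are distinct points, `S` is the union of all vertices and edges, an edge contains
no vertices other than its endpoints, and distinct edges meet at most in common endpoints. -/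
structure IsGeometricRealization {V E : Type*} [AddCommGroup E] [Module ℝ E]
    (G : SimpleGraph V) (p : V → E) (S : Set E) : Prop where
  injective : Function.Injective p
  carrier : S = Set.range p ∪ {f | ∃ a b, G.Adj a b ∧ f ∈ segment ℝ (p a) (p b)}
  vertex_edge : ∀ a b c, G.Adj a b → p c ∈ segment ℝ (p a) (p b) → c = a ∨ c = b
  edge_edge : ∀ a b a' b', G.Adj a b → G.Adj a' b' → s(a, b) ≠ s(a', b') →
    segment ℝ (p a) (p b) ∩ segment ℝ (p a') (p b') ⊆ p '' ({a, b} ∩ {a', b'})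

end YoungHull

/-! A partition `μ` is sent to its vector of distances to `X_N`. Graph distance counts the boxes in
a symmetric difference, so a pair `x, y` is tight at `μ` iff `x ∩ y ⊆ μ ⊆ x ∪ y`. Every bounded face
of `Δ(X)` is the set `tightFace d f` for a point `f` of that face with as few tight pairs as
possible, so dimensions can be read off from the directions that preserve tightness.

Each tight face contains a partition (`exists_hullPoint_mem_tightFace`), namely the union of `x ∩ y`
over the tight pairs of `f`. This works because the rectangles containing a given box `(r, c)` are
those with index `c < j < N - r`, an arc in the cyclic order of `X_N`, and arcs cannot realize all
three ways of splitting four points into two pairs (`mem_or_mem_of_tight`). Hence all vertices are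
partitions.

Conversely, adding a box `b` destroys exactly one tight pair (`exists_tight_pair_notMem`), while
removing it destroys one that contains `b` twice (`exists_tight_pair_mem`). By induction on boxes
each partition is a vertex, and the constraints shared by two neighbours leave only the line spanned
by `boxSign b` (`eq_smul_boxSign`), so Hasse edges are one-dimensional faces. In the other
direction, each box in which two partitions of one face differ contributes a direction `boxSign b`
to that face. Different boxes give independent directions, so a one-dimensional face joins
neighbours (`adj_of_finrank_eq_one`). -/

namespace YoungHull

/-! ### Faces of the polyhedron described by tight constraints. -/

section Polyhedron

variable {X : Type*}

/-- The points of the polyhedron at which all constraints that are tight at `f` are tight. -/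
def tightFace (d : X → X → ℝ) (f : X → ℝ) : Set (X → ℝ) :=
  {g | g ∈ polyhedron d ∧ ∀ x y, f x + f y = d x y → g x + g y = d x y}

/-- The directions along which all constraints that are tight at `f` stay tight. -/
def IsTightDir (d : X → X → ℝ) (f v : X → ℝ) : Prop :=
  ∀ x y, f x + f y = d x y → v x + v y = 0

theorem self_mem_tightFace {d : X → X → ℝ} {f : X → ℝ} (hf : f ∈ polyhedron d) :
    f ∈ tightFace d f := ⟨hf, fun _ _ h => h⟩

theorem isTightDir_sub {d : X → X → ℝ} {f g h : X → ℝ} (hg : g ∈ tightFace d f)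
    (hh : h ∈ tightFace d f) : IsTightDir d f (g - h) := by
  intro x y hxy
  have := hg.2 x y hxy
  have := hh.2 x y hxy
  simp only [Pi.sub_apply]
  linarith

theorem convex_tightFace (d : X → X → ℝ) (f : X → ℝ) : Convex ℝ (tightFace d f) := by
  rintro g ⟨hg, hg'⟩ h ⟨hh, hh'⟩ a b ha hb hab
  have key : ∀ x y, (a • g + b • h) x + (a • g + b • h) y - d x y
      = a * (g x + g y - d x y) + b * (h x + h y - d x y) := by
    intro x y
    simp only [Pi.add_apply, Pi.smul_apply, smul_eq_mul]
    linear_combination d x y * hab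
  refine ⟨fun x y => ?_, fun x y hxy => ?_⟩
  · have h1 := mul_nonneg ha (sub_nonneg.2 (hg x y))
    have h2 := mul_nonneg hb (sub_nonneg.2 (hh x y))
    linarith [key x y]
  · have := key x y
    rw [hg' x y hxy, hh' x y hxy] at this
    linarith

theorem isClosed_tightFace (d : X → X → ℝ) (f : X → ℝ) : IsClosed (tightFace d f) := by
  have : tightFace d f = (⋂ x, ⋂ y, {g : X → ℝ | d x y ≤ g x + g y}) ∩
      ⋂ x, ⋂ y, ⋂ _ : f x + f y = d x y, {g : X → ℝ | g x + g y = d x y} := by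
    ext g
    simp [tightFace, polyhedron]
  rw [this]
  refine IsClosed.inter ?_ ?_
  · exact isClosed_iInter fun x => isClosed_iInter fun y =>
      isClosed_le continuous_const ((continuous_apply x).add (continuous_apply y))
  · exact isClosed_iInter fun x => isClosed_iInter fun y => isClosed_iInter fun _ =>
      isClosed_eq ((continuous_apply x).add (continuous_apply y)) continuous_const

/-- The constraints that are not tight at `f` are finitely many and have positive slack, so a small
move in either direction respects them. -/
theorem exists_smul_mem_tightFace [Finite X] {d : X → X → ℝ} {f v : X → ℝ}
    (hf : f ∈ polyhedron d) (hv : IsTightDir d f v) :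
    ∃ ε : ℝ, 0 < ε ∧ ∀ t, |t| ≤ ε → f + t • v ∈ tightFace d f := by
  have hloc : ∀ q : X × X, ∃ ε : ℝ, 0 < ε ∧
      ∀ t, |t| ≤ ε → d q.1 q.2 ≤ (f + t • v) q.1 + (f + t • v) q.2 := by
    rintro ⟨x, y⟩
    simp only [Pi.add_apply, Pi.smul_apply, smul_eq_mul]
    rcases (hf x y).eq_or_lt with h | h
    · refine ⟨1, one_pos, fun t _ => le_of_eq ?_⟩
      linear_combination h - t * hv x y h.symm
    · have hpos : 0 < |v x + v y| + 1 := by positivity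
      refine ⟨(f x + f y - d x y) / (|v x + v y| + 1), div_pos (by linarith) hpos, fun t ht => ?_⟩
      rw [le_div_iff₀ hpos] at ht
      have h1 : |t * (v x + v y)| ≤ |t| * (|v x + v y| + 1) := by
        rw [abs_mul]
        exact mul_le_mul_of_nonneg_left (by linarith) (abs_nonneg t)
      have h2 := neg_abs_le (t * (v x + v y))
      linarith
  choose ε hε hεd using hloc
  obtain ⟨δ, hδ, hδε⟩ : ∃ δ : ℝ, 0 < δ ∧ ∀ q, δ ≤ ε q := by
    rcases isEmpty_or_nonempty (X × X) with h | h
    · exact ⟨1, one_pos, fun q => h.elim q⟩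
    · obtain ⟨q, hq⟩ := Finite.exists_min ε
      exact ⟨ε q, hε q, hq⟩
  refine ⟨δ, hδ, fun t ht => ⟨fun x y => hεd (x, y) t (ht.trans (hδε _)), fun x y hxy => ?_⟩⟩
  have := hv x y hxy
  simp only [Pi.add_apply, Pi.smul_apply, smul_eq_mul]
  linear_combination hxy + t * this

/-- A positive combination of two nonnegative slacks vanishes only if both do. -/
theorem midpoint_tight {d : X → X → ℝ} {f g : X → ℝ} (hf : f ∈ polyhedron d)
    (hg : g ∈ polyhedron d) {a b : ℝ} (ha : 0 < a) (hb : 0 < b) (hab : a + b = 1) {x y : X} :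
    (a • f + b • g) x + (a • f + b • g) y = d x y ↔
      f x + f y = d x y ∧ g x + g y = d x y := by
  have h1 := hf x y
  have h2 := hg x y
  simp only [Pi.add_apply, Pi.smul_apply, smul_eq_mul]
  constructor
  · intro h
    have h3 : a * (f x + f y - d x y) + b * (g x + g y - d x y) = 0 := by
      linear_combination h - d x y * hab
    have h4 := mul_nonneg ha.le (sub_nonneg.2 h1)
    have h5 := mul_nonneg hb.le (sub_nonneg.2 h2)
    have h6 : a * (f x + f y - d x y) = 0 := by linarith
    have h7 : b * (g x + g y - d x y) = 0 := by linarith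
    rw [mul_eq_zero] at h6 h7
    constructor
    · rcases h6 with h | h <;> linarith
    · rcases h7 with h | h <;> linarith
  · rintro ⟨h3, h4⟩
    linear_combination a * h3 + b * h4 + d x y * hab

theorem exists_eq_tightFace [Finite X] {d : X → X → ℝ} {F : Set (X → ℝ)} (hF : F ∈ hullFaces d) :
    ∃ f ∈ F, f ∈ polyhedron d ∧ F = tightFace d f := by
  obtain ⟨hne, hexp, -⟩ := hF
  obtain ⟨l, rfl⟩ := hexp hne
  set F := {g ∈ polyhedron d | ∀ y ∈ polyhedron d, l y ≤ l g}
  let T : (X → ℝ) → Set (X × X) := fun g => {q | g q.1 + g q.2 = d q.1 q.2}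
  -- A point of `F` with the fewest tight pairs plays the role of a relative interior point:
  -- averaging it with any `g` in `F` cannot lose a tight pair.
  obtain ⟨f, hf, hmin⟩ := exists_minimalFor_of_wellFoundedLT (fun g => g ∈ F)
    (fun g => (T g).ncard) hne
  refine ⟨f, hf, hf.1, Set.Subset.antisymm (fun g hg => ⟨hg.1, fun x y hxy => ?_⟩) ?_⟩
  · have h2 : (0 : ℝ) < 1 / 2 := by norm_num
    have hmid : ((1 / 2 : ℝ) • f + (1 / 2 : ℝ) • g) ∈ F := by
      refine ⟨fun x y => ?_, fun z hz => ?_⟩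
      · have := hf.1 x y
        have := hg.1 x y
        simp only [Pi.add_apply, Pi.smul_apply, smul_eq_mul]
        linarith
      · have := hf.2 z hz
        have := hg.2 z hz
        simp only [map_add, map_smul, smul_eq_mul]
        linarith
    have hsub : T ((1 / 2 : ℝ) • f + (1 / 2 : ℝ) • g) ⊆ T f := fun q hq =>
      ((midpoint_tight hf.1 hg.1 h2 h2 (by norm_num)).1 hq).1
    have heq := Set.eq_of_subset_of_ncard_le hsub
      (hmin hmid (Set.ncard_le_ncard hsub (Set.toFinite _))) (Set.toFinite _)
    have : (x, y) ∈ T f := hxy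
    rw [← heq] at this
    exact ((midpoint_tight hf.1 hg.1 h2 h2 (by norm_num)).1 this).2
  · intro g hg
    -- Stepping from `f` away from `g` stays in the polyhedron, so maximality of `l` at `f` forces
    -- `l f ≤ l g`.
    obtain ⟨ε, hε, hεf⟩ := exists_smul_mem_tightFace hf.1
      (isTightDir_sub (self_mem_tightFace hf.1) hg)
    have h1 := hf.2 _ (hεf ε (abs_of_pos hε).le).1
    simp only [map_add, map_smul, map_sub, smul_eq_mul] at h1
    have h2 : l f ≤ l g := by
      by_contra! h
      have := mul_pos hε (sub_pos.2 h)
      linarith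
    exact ⟨hg.1, fun z hz => (hf.2 z hz).trans h2⟩

/-- Minus the sum of the tight constraints is a functional exposing this face. It is bounded because
in the hull every coordinate has a tight partner, which bounds it above. -/
theorem tightFace_mem_hullFaces [Finite X] {d : X → X → ℝ} {f : X → ℝ} (hf : f ∈ injHull d) :
    tightFace d f ∈ hullFaces d := by
  classical
  have := Fintype.ofFinite X
  refine ⟨⟨f, self_mem_tightFace hf.1⟩, fun _ => ?_, ?_⟩
  · let S : Finset (X × X) := Finset.univ.filter fun q => f q.1 + f q.2 = d q.1 q.2
    let l : StrongDual ℝ (X → ℝ) :=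
      -∑ q ∈ S, (ContinuousLinearMap.proj (R := ℝ) (φ := fun _ : X => ℝ) q.1
        + ContinuousLinearMap.proj (R := ℝ) (φ := fun _ : X => ℝ) q.2)
    have hl : ∀ g, l g = -∑ q ∈ S, (g q.1 + g q.2) := by
      intro g
      simp [l]
    have hS : ∀ q ∈ S, f q.1 + f q.2 = d q.1 q.2 := fun q hq => (Finset.mem_filter.1 hq).2
    have hle : ∀ g ∈ polyhedron d, ∑ q ∈ S, d q.1 q.2 ≤ ∑ q ∈ S, (g q.1 + g q.2) :=
      fun g hg => Finset.sum_le_sum fun q _ => hg _ _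
    have hfs : ∑ q ∈ S, (f q.1 + f q.2) = ∑ q ∈ S, d q.1 q.2 := Finset.sum_congr rfl hS
    refine ⟨l, Set.Subset.antisymm (fun g hg => ⟨hg.1, fun z hz => ?_⟩) ?_⟩
    · rw [hl, hl, neg_le_neg_iff]
      refine le_of_eq_of_le (Finset.sum_congr rfl fun q hq => hg.2 _ _ (hS q hq)) (hle z hz)
    · rintro g ⟨hg, hmax⟩
      refine ⟨hg, fun x y hxy => ?_⟩
      have h1 := hmax f hf.1
      rw [hl, hl, neg_le_neg_iff, hfs] at h1
      exact ((Finset.sum_eq_sum_iff_of_le fun q _ => hg q.1 q.2).1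
        (le_antisymm (hle g hg) h1) (x, y) (by simp [S, hxy])).symm
  · rw [← Bornology.forall_isBounded_image_eval_iff]
    intro x
    obtain ⟨y, hy⟩ := hf.2 x
    refine (Metric.isBounded_Icc (d x x / 2) (d x y - d y y / 2)).subset ?_
    rintro _ ⟨g, hg, rfl⟩
    have h1 := hg.2 x y hy
    have h2 := hg.1 x x
    have h3 := hg.1 y y
    simp only [Function.eval, Set.mem_Icc]
    constructor <;> linarith

theorem isTightDir_eq_zero_of_mem_extremePoints [Finite X] {d : X → X → ℝ} {f g v : X → ℝ}
    (hg : g ∈ (tightFace d f).extremePoints ℝ) (hv : IsTightDir d g v) : v = 0 := by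
  obtain ⟨ε, hε, h⟩ := exists_smul_mem_tightFace hg.1.1 hv
  have hsub : tightFace d g ⊆ tightFace d f := fun u hu =>
    ⟨hu.1, fun x y hxy => hu.2 x y (hg.1.2 x y hxy)⟩
  have h1 := hsub (h ε (abs_of_pos hε).le)
  have h2 := hsub (h (-ε) (by rw [abs_neg, abs_of_pos hε]))
  have h3 := hg.2 h1 h2 ⟨1 / 2, 1 / 2, by norm_num, by norm_num, by norm_num, by module⟩
  simpa [hε.ne'] using h3

/-- Krein–Milman: a compact convex set with at most one extreme point has at most one point. -/
theorem exists_extremePoints_ne [Finite X] {d : X → X → ℝ} {f : X → ℝ}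
    (hF : tightFace d f ∈ hullFaces d) (hns : ¬ (tightFace d f).Subsingleton) :
    ∃ g ∈ (tightFace d f).extremePoints ℝ, ∃ h ∈ (tightFace d f).extremePoints ℝ, g ≠ h := by
  have := Fintype.ofFinite X
  by_contra! hcon
  have hcomp : IsCompact (tightFace d f) :=
    Metric.isCompact_of_isClosed_isBounded (isClosed_tightFace d f) hF.2.2
  have hkm := closure_convexHull_extremePoints hcomp (convex_tightFace d f)
  have hss : ((tightFace d f).extremePoints ℝ).Subsingleton := fun g hg h hh => hcon g hg h hh
  apply hns
  rw [← hkm]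
  rcases hss.eq_empty_or_singleton with h | ⟨g, h⟩ <;> simp [h]

theorem mem_vectorSpan_tightFace [Finite X] {d : X → X → ℝ} {f v : X → ℝ}
    (hf : f ∈ polyhedron d) (hv : IsTightDir d f v) : v ∈ vectorSpan ℝ (tightFace d f) := by
  obtain ⟨ε, hε, h⟩ := exists_smul_mem_tightFace hf hv
  have h1 := vsub_mem_vectorSpan ℝ (h ε (abs_of_pos hε).le) (self_mem_tightFace hf)
  have h2 := Submodule.smul_mem _ ε⁻¹ h1
  simpa [hε.ne', smul_smul] using h2

/-- If `x` occurred in no tight pair, the coordinate at `x` could be varied freely. -/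
theorem mem_injHull_of_isTightDir_single [DecidableEq X] {d : X → X → ℝ} {f : X → ℝ}
    (hd : ∀ x y, d x y = d y x) (hf : f ∈ polyhedron d)
    (h : ∀ x, ¬ IsTightDir d f (Pi.single x 1)) : f ∈ injHull d := by
  refine ⟨hf, fun x => ?_⟩
  by_contra! hx
  refine h x fun a b hab => ?_
  rw [Pi.single_eq_of_ne, Pi.single_eq_of_ne, add_zero]
  · rintro rfl
    exact hx a (by rw [add_comm, hab, hd])
  · rintro rfl
    exact hx b hab

end Polyhedron

/-! ### Young diagrams, hooks and adding a box. -/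

section Diagrams

theorem mem_rect {r c a b : ℕ} : (a, b) ∈ rect r c ↔ a < r ∧ b < c := by
  rw [← YoungDiagram.mem_cells]
  simp [rect]

/-- The hook at the origin is the longest, so only the lengths of the first row and first column
matter. -/
theorem hookLength_lt_iff {N : ℕ} {μ : YoungDiagram} :
    (∀ i j : ℕ, (i, j) ∈ μ → hookLength μ i j < N) ↔
      ∀ r c : ℕ, (r, 0) ∈ μ → (0, c) ∈ μ → r + c + 2 ≤ N := by
  constructor
  · intro h r c hr hc
    have h0 := h 0 0 (μ.up_left_mem (Nat.zero_le _) le_rfl hr)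
    rw [YoungDiagram.mem_iff_lt_rowLen] at hc
    rw [YoungDiagram.mem_iff_lt_colLen] at hr
    unfold hookLength at h0
    omega
  · intro h i j hij
    have hr : (i, 0) ∈ μ := μ.up_left_mem le_rfl (Nat.zero_le _) hij
    have hc : (0, j) ∈ μ := μ.up_left_mem (Nat.zero_le _) le_rfl hij
    have h1 := μ.rowLen_anti 0 i (Nat.zero_le _)
    have h2 := μ.colLen_anti 0 j (Nat.zero_le _)
    have h3 := YoungDiagram.mem_iff_lt_rowLen.1 hij
    have h4 := YoungDiagram.mem_iff_lt_colLen.1 hij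
    have h5 := h (μ.colLen 0 - 1) (μ.rowLen 0 - 1)
      (YoungDiagram.mem_iff_lt_colLen.2 (by omega)) (YoungDiagram.mem_iff_lt_rowLen.2 (by omega))
    unfold hookLength
    omega

theorem add_le_of_mem {N : ℕ} (μ : YN N) {r c r' c' : ℕ} (h : (r, c') ∈ μ.1) (h' : (r', c) ∈ μ.1) :
    r + c + 2 ≤ N :=
  hookLength_lt_iff.1 μ.2 r c (μ.1.up_left_mem le_rfl (Nat.zero_le _) h)
    (μ.1.up_left_mem (Nat.zero_le _) le_rfl h')

/-- A diagram contained in a member of `𝕐_N` is in `𝕐_N`. -/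
theorem hookLength_lt_of_le {N : ℕ} {ν : YoungDiagram} (μ : YN N) (h : ν ≤ μ.1) :
    ∀ i j : ℕ, (i, j) ∈ ν → hookLength ν i j < N :=
  hookLength_lt_iff.2 fun _ _ hr hc => hookLength_lt_iff.1 μ.2 _ _ (h hr) (h hc)

/-- `μ` arises from `ν` by adding the box `b`. -/
def AddsBox (ν μ : YoungDiagram) (b : ℕ × ℕ) : Prop :=
  b ∉ ν ∧ ∀ x, x ∈ μ ↔ x = b ∨ x ∈ ν

namespace AddsBox

variable {ν μ ρ : YoungDiagram} {b : ℕ × ℕ}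

theorem mem (h : AddsBox ν μ b) : b ∈ μ := (h.2 b).2 (Or.inl rfl)

theorem le (h : AddsBox ν μ b) : ν ≤ μ := fun x hx => (h.2 x).2 (Or.inr hx)

theorem cells_eq (h : AddsBox ν μ b) : μ.cells = insert b ν.cells := by
  ext x
  simpa using h.2 x

theorem left_unique (h : AddsBox ν μ b) (h' : AddsBox ρ μ b) : ν = ρ := by
  ext x
  have h1 := h.2 x
  have h2 := h'.2 x
  have h3 := h.1
  have h4 := h'.1
  simp only [YoungDiagram.mem_cells]
  by_cases hx : x = b
  · subst hx; tauto
  · tauto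

theorem right_unique (h : AddsBox ν μ b) (h' : AddsBox ν ρ b) : μ = ρ := by
  ext x
  simp only [YoungDiagram.mem_cells]
  rw [h.2, h'.2]

/-- No box of the larger diagram lies strictly beyond the added box. -/
theorem eq_of_le (h : AddsBox ν μ b) {x : ℕ × ℕ} (hx : x ∈ μ) (h1 : b.1 ≤ x.1) (h2 : b.2 ≤ x.2) :
    x = b := by
  rcases (h.2 x).1 hx with h3 | h3
  · exact h3
  · exact absurd (ν.up_left_mem h1 h2 h3) h.1

end AddsBox

/-- If `μ` is not contained in `ν`, some corner of `μ` outside `ν` can be removed. -/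
theorem exists_addsBox_of_not_le {ν μ : YoungDiagram} (h : ¬ μ ≤ ν) :
    ∃ b ρ, b ∉ ν ∧ AddsBox ρ μ b := by
  classical
  have hne : (μ.cells \ ν.cells).Nonempty := by
    rw [Finset.sdiff_nonempty]
    exact h
  -- A maximal box of `μ` outside `ν` is a corner of `μ`: a box of `μ` beyond it would lie in `ν`
  -- and drag `b` into `ν`.
  obtain ⟨b, hb⟩ := Finset.exists_maximal hne
  have hb1 := Finset.mem_sdiff.1 hb.1
  refine ⟨b, ⟨μ.cells.erase b, ?_⟩, hb1.2, ?_, ?_⟩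
  · intro x y hyx hx
    simp only [Finset.coe_erase, Set.mem_sdiff, Finset.mem_coe, Set.mem_singleton_iff] at hx ⊢
    refine ⟨μ.isLowerSet hyx hx.1, ?_⟩
    rintro rfl
    have hxν : x ∉ ν.cells := fun hxν => hb1.2 (ν.isLowerSet hyx hxν)
    exact hx.2 (le_antisymm (hb.2 (Finset.mem_sdiff.2 ⟨hx.1, hxν⟩) hyx) hyx)
  · rw [← YoungDiagram.mem_cells]
    simp
  · intro x
    rw [← YoungDiagram.mem_cells, ← YoungDiagram.mem_cells]
    have := hb1.1
    by_cases hx : x = b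
    · subst hx; simpa using this
    · simp [hx]

/-- Adding a box to a diagram that contains all boxes before it. -/
theorem exists_addsBox_left {ν : YoungDiagram} {b : ℕ × ℕ} (hb : b ∉ ν)
    (h : ∀ x ≤ b, x ≠ b → x ∈ ν) : ∃ μ, AddsBox ν μ b := by
  classical
  refine ⟨⟨insert b ν.cells, ?_⟩, hb, fun x => ?_⟩
  · intro x y hyx hx
    simp only [Finset.coe_insert, Set.mem_insert_iff, Finset.mem_coe] at hx ⊢
    by_cases hy : y = b
    · exact Or.inl hy
    · rcases hx with rfl | hx
      · exact Or.inr (h y hyx hy)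
      · exact Or.inr (ν.isLowerSet hyx hx)
  · rw [← YoungDiagram.mem_cells, ← YoungDiagram.mem_cells]
    simp

/-! ### Covering relations and the graph distance. -/

theorem covBy_iff {N : ℕ} {ν μ : YN N} : ν ⋖ μ ↔ ∃ b, AddsBox ν.1 μ.1 b := by
  constructor
  · intro h
    have hlt : ν.1 < μ.1 := h.lt
    obtain ⟨b, ρ, hbν, hρ⟩ := exists_addsBox_of_not_le hlt.not_ge
    have hνρ : ν.1 ≤ ρ := by
      intro x hx
      rcases (hρ.2 x).1 (hlt.le hx) with rfl | h1
      · exact absurd hx hbν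
      · exact h1
    have hρμ : ρ < μ.1 := lt_of_le_of_ne hρ.le fun h => hρ.1 (h ▸ hρ.mem)
    let ρ' : YN N := ⟨ρ, hookLength_lt_of_le μ hρ.le⟩
    have hle : ν ≤ ρ' := hνρ
    have hlt' : ρ' < μ := hρμ
    rcases hle.eq_or_lt with h1 | h1
    · exact ⟨b, by rw [h1]; exact hρ⟩
    · exact absurd hlt' (h.2 h1)
  · rintro ⟨b, hb⟩
    have hle : ν ≤ μ := hb.le
    refine ⟨lt_of_le_of_ne hle fun h => hb.1 (h ▸ hb.mem), fun ρ h1 h2 => ?_⟩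
    by_cases hbρ : b ∈ ρ.1
    · have h3 : μ ≤ ρ := by
        intro x hx
        rcases (hb.2 x).1 hx with rfl | h3
        · exact hbρ
        · exact h1.le h3
      exact h2.not_ge h3
    · have h3 : ρ ≤ ν := by
        intro x hx
        rcases (hb.2 x).1 (h2.le hx) with rfl | h3
        · exact absurd hx hbρ
        · exact h3
      exact h1.not_ge h3

theorem hasseYN_adj_iff {N : ℕ} {ν μ : YN N} :
    (hasseYN N).Adj ν μ ↔ ∃ b, AddsBox ν.1 μ.1 b ∨ AddsBox μ.1 ν.1 b := by
  rw [SimpleGraph.hasse_adj, covBy_iff, covBy_iff, exists_or]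

/-- The number of boxes in which two diagrams differ. -/
def boxDist (μ ν : YoungDiagram) : ℕ := (symmDiff μ.cells ν.cells).card

theorem boxDist_comm (μ ν : YoungDiagram) : boxDist μ ν = boxDist ν μ := by
  rw [boxDist, symmDiff_comm, boxDist]

theorem boxDist_self (μ : YoungDiagram) : boxDist μ μ = 0 := by
  simp [boxDist]

theorem boxDist_triangle (μ ν ρ : YoungDiagram) : boxDist μ ρ ≤ boxDist μ ν + boxDist ν ρ :=
  (Finset.card_le_card (symmDiff_triangle _ _ _)).trans (Finset.card_union_le _ _)

theorem AddsBox.boxDist_of_notMem {ν μ ρ : YoungDiagram} {b : ℕ × ℕ} (h : AddsBox ν μ b)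
    (hb : b ∉ ρ) : boxDist μ ρ = boxDist ν ρ + 1 := by
  have hb1 := h.1
  rw [← YoungDiagram.mem_cells] at hb hb1
  have : symmDiff μ.cells ρ.cells = insert b (symmDiff ν.cells ρ.cells) := by
    rw [h.cells_eq]
    ext x
    simp only [Finset.mem_symmDiff, Finset.mem_insert]
    by_cases hx : x = b
    · subst hx; tauto
    · tauto
  rw [boxDist, this, Finset.card_insert_of_notMem, boxDist]
  simp only [Finset.mem_symmDiff]
  tauto

theorem AddsBox.boxDist_of_mem {ν μ ρ : YoungDiagram} {b : ℕ × ℕ} (h : AddsBox ν μ b)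
    (hb : b ∈ ρ) : boxDist ν ρ = boxDist μ ρ + 1 := by
  have hb1 := h.1
  rw [← YoungDiagram.mem_cells] at hb hb1
  have : symmDiff ν.cells ρ.cells = insert b (symmDiff μ.cells ρ.cells) := by
    rw [h.cells_eq]
    ext x
    simp only [Finset.mem_symmDiff, Finset.mem_insert]
    by_cases hx : x = b
    · subst hx; tauto
    · tauto
  rw [boxDist, this, Finset.card_insert_of_notMem, boxDist]
  simp only [Finset.mem_symmDiff, h.cells_eq, Finset.mem_insert]
  tauto

theorem boxDist_of_adj {N : ℕ} {ν μ : YN N} (h : (hasseYN N).Adj ν μ) :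
    boxDist ν.1 μ.1 = 1 := by
  obtain ⟨b, h | h⟩ := hasseYN_adj_iff.1 h
  · rw [h.boxDist_of_mem h.mem, boxDist_self]
  · rw [h.boxDist_of_notMem h.1, boxDist_self]

/-- The graph distance of the Hasse graph counts the boxes in which two diagrams differ. -/
theorem dist_hasseYN {N : ℕ} (ν μ : YN N) : (hasseYN N).dist ν μ = boxDist ν.1 μ.1 := by
  apply le_antisymm
  · have key : ∀ n, ∀ ν μ : YN N, boxDist ν.1 μ.1 = n → (hasseYN N).dist ν μ ≤ n := by
      intro n
      induction n with
      | zero =>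
        intro ν μ h
        rw [boxDist, Finset.card_eq_zero, ← Finset.bot_eq_empty, symmDiff_eq_bot] at h
        have : ν = μ := Subtype.ext (YoungDiagram.ext h)
        simp [this]
      | succ n ih =>
        -- Removing a corner stays inside `𝕐_N`, whereas adding a box might not; so the path always
        -- shrinks whichever diagram is not contained in the other.
        have aux : ∀ ν μ : YN N, ¬ μ.1 ≤ ν.1 → boxDist ν.1 μ.1 = n + 1 →
            (hasseYN N).dist ν μ ≤ n + 1 := by
          intro ν μ hle h
          obtain ⟨b, ρ, hb, hρ⟩ := exists_addsBox_of_not_le hle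
          let ρ' : YN N := ⟨ρ, hookLength_lt_of_le μ hρ.le⟩
          have h1 : boxDist ν.1 ρ'.1 = n := by
            have := hρ.boxDist_of_notMem hb
            rw [boxDist_comm _ ν.1, boxDist_comm _ ν.1] at this
            change boxDist ν.1 ρ = n
            omega
          have h2 : (hasseYN N).Adj ρ' μ := hasseYN_adj_iff.2 ⟨b, Or.inl hρ⟩
          have h3 := ih ν ρ' h1
          have h4 := connected_hasseYN.dist_triangle (u := ν) (v := ρ') (w := μ)
          rw [SimpleGraph.dist_eq_one_iff_adj.2 h2] at h4
          omega
        intro ν μ h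
        by_cases hle : μ.1 ≤ ν.1
        · by_cases hle' : ν.1 ≤ μ.1
          · rw [le_antisymm hle hle', boxDist_self] at h
            omega
          · rw [boxDist_comm] at h
            rw [SimpleGraph.dist_comm]
            exact aux μ ν hle' h
        · exact aux ν μ hle h
    exact key _ ν μ rfl
  · have key : ∀ ν μ : YN N, ∀ w : (hasseYN N).Walk ν μ, boxDist ν.1 μ.1 ≤ w.length := by
      intro ν μ w
      induction w with
      | nil => simp [boxDist_self]
      | @cons a b c hab w ih =>
        have h1 := boxDist_triangle a.1 b.1 c.1
        rw [boxDist_of_adj hab] at h1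
        rw [SimpleGraph.Walk.length_cons]
        omega
    obtain ⟨w, hw⟩ := (connected_hasseYN (N := N)).exists_walk_length_eq_dist ν μ
    rw [← hw]
    exact key ν μ w

/-! ### Rectangles and the pendant vertices. -/

theorem rect_mem_YN {N j : ℕ} (hj : j ≤ N) :
    ∀ i k : ℕ, (i, k) ∈ rect (N - j) j → hookLength (rect (N - j) j) i k < N := by
  refine hookLength_lt_iff.2 fun r c hr hc => ?_
  rw [mem_rect] at hr hc
  omega

theorem rect_zero (r : ℕ) : rect r 0 = ⊥ := by
  ext ⟨a, b⟩
  rw [YoungDiagram.mem_cells, mem_rect]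
  simp

theorem rect_zero_left (c : ℕ) : rect 0 c = ⊥ := by
  ext ⟨a, b⟩
  rw [YoungDiagram.mem_cells, mem_rect]
  simp

theorem bot_mem_pendantVertices {N : ℕ} (hN : 2 ≤ N) {μ : YN N} (h : μ.1 = ⊥) :
    μ ∈ pendantVertices (hasseYN N) := by
  obtain ⟨ν, hν⟩ : ∃ ν, AddsBox μ.1 ν (0, 0) := by
    apply exists_addsBox_left
    · rw [h]; exact YoungDiagram.notMem_bot _
    · rintro ⟨a, b⟩ hx hne
      simp only [Prod.mk_le_mk, Nat.le_zero] at hx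
      exact absurd (Prod.ext hx.1 hx.2) hne
  have hmem : ∀ x, x ∈ ν ↔ x = (0, 0) := fun x => by
    rw [hν.2, h]
    simp
  have hνN : ∀ i j : ℕ, (i, j) ∈ ν → hookLength ν i j < N := by
    refine hookLength_lt_iff.2 fun r c hr hc => ?_
    simp only [hmem, Prod.mk.injEq] at hr hc
    omega
  refine ⟨⟨ν, hνN⟩, hasseYN_adj_iff.2 ⟨_, Or.inl hν⟩, fun ρ hρ => ?_⟩
  obtain ⟨b, hb | hb⟩ := hasseYN_adj_iff.1 hρ
  · have h0 : (0, 0) ∈ ρ.1 := ρ.1.up_left_mem (Nat.zero_le _) (Nat.zero_le _) hb.mem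
    have : (0, 0) = b := by
      rcases (hb.2 _).1 h0 with h1 | h1
      · exact h1
      · rw [h] at h1
        exact absurd h1 (YoungDiagram.notMem_bot _)
    subst this
    exact Subtype.ext (hb.right_unique hν)
  · have := hb.mem
    rw [h] at this
    exact absurd this (YoungDiagram.notMem_bot _)

/-- The side lengths add up to `N`, so no box can be added, and a rectangle has a single corner to
remove. -/
theorem rect_mem_pendantVertices {N j : ℕ} (hj : 1 ≤ j) (hjN : j ≤ N - 1) {μ : YN N}
    (h : μ.1 = rect (N - j) j) : μ ∈ pendantVertices (hasseYN N) := by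
  have hmem : ∀ a b, (a, b) ∈ μ.1 ↔ a < N - j ∧ b < j := fun a b => by rw [h, mem_rect]
  have hlast : (N - j - 1, j - 1) ∈ μ.1 := (hmem _ _).2 (by omega)
  have hcorner : ∀ b ρ, AddsBox ρ μ.1 b → b = (N - j - 1, j - 1) := by
    rintro ⟨r, c⟩ ρ hb
    have := (hmem _ _).1 hb.mem
    exact (hb.eq_of_le hlast (by simp only; omega) (by simp only; omega)).symm
  obtain ⟨b, ρ, -, hρ⟩ : ∃ b ρ, b ∉ (⊥ : YoungDiagram) ∧ AddsBox ρ μ.1 b :=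
    exists_addsBox_of_not_le fun hle => YoungDiagram.notMem_bot _ (hle hlast)
  refine ⟨⟨ρ, hookLength_lt_of_le μ hρ.le⟩, hasseYN_adj_iff.2 ⟨b, Or.inr hρ⟩, fun ν hν => ?_⟩
  obtain ⟨⟨r, c⟩, hb | hb⟩ := hasseYN_adj_iff.1 hν
  · have h1 := hb.1
    rw [hmem] at h1
    have h2 := add_le_of_mem ν (hb.le hlast) hb.mem
    have h3 := add_le_of_mem ν hb.mem (hb.le hlast)
    omega
  · rw [hcorner _ _ hb] at hb
    rw [hcorner _ _ hρ] at hρ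
    exact Subtype.ext (hb.left_unique hρ)

theorem mem_pendantVertices_iff {N : ℕ} (hN : 2 ≤ N) (μ : YN N) :
    μ ∈ pendantVertices (hasseYN N) ↔
      μ.1 = ⊥ ∨ ∃ j : ℕ, 1 ≤ j ∧ j ≤ N - 1 ∧ μ.1 = rect (N - j) j := by
  constructor
  · rintro ⟨w, -, hw⟩
    have huniq : ∀ ν ρ : YN N, (hasseYN N).Adj μ ν → (hasseYN N).Adj μ ρ → ν = ρ :=
      fun ν ρ hν hρ => (hw ν hν).trans (hw ρ hρ).symm
    by_cases hbot : μ.1 = ⊥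
    · exact Or.inl hbot
    right
    have h00 : (0, 0) ∈ μ.1 := by
      by_contra h0
      refine hbot (le_bot_iff.1 fun x hx => ?_)
      exact absurd (μ.1.up_left_mem (Nat.zero_le _) (Nat.zero_le _) hx) h0
    set a := μ.1.rowLen 0 with ha
    set l := μ.1.colLen 0 with hl
    have hrow : ∀ c, (0, c) ∈ μ.1 ↔ c < a := fun c => YoungDiagram.mem_iff_lt_rowLen
    have hcol : ∀ r, (r, 0) ∈ μ.1 ↔ r < l := fun r => YoungDiagram.mem_iff_lt_colLen
    have ha0 := (hrow 0).1 h00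
    have hl0 := (hcol 0).1 h00
    have hle : ∀ {r c}, (r, c) ∈ μ.1 → r < l ∧ c < a := fun {r c} h =>
      ⟨(hcol r).1 (μ.1.up_left_mem le_rfl (Nat.zero_le _) h),
        (hrow c).1 (μ.1.up_left_mem (Nat.zero_le _) le_rfl h)⟩
    have hal := add_le_of_mem μ ((hcol (l - 1)).2 (by omega)) ((hrow (a - 1)).2 (by omega))
    -- If there is room for a longer hook, both the first row and the first column can be extended,
    -- giving two neighbours.
    by_cases hlt : a + l < N
    · exfalso
      obtain ⟨ν, hν⟩ : ∃ ν, AddsBox μ.1 ν (0, a) := by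
        apply exists_addsBox_left
        · rw [hrow]; omega
        · rintro ⟨x, y⟩ hx hne
          simp only [Prod.mk_le_mk, Nat.le_zero] at hx
          obtain ⟨rfl, hx⟩ := hx
          simp only [ne_eq, Prod.mk.injEq, true_and] at hne
          rw [hrow]; omega
      obtain ⟨ρ, hρ⟩ : ∃ ρ, AddsBox μ.1 ρ (l, 0) := by
        apply exists_addsBox_left
        · rw [hcol]; omega
        · rintro ⟨x, y⟩ hx hne
          simp only [Prod.mk_le_mk, Nat.le_zero] at hx
          obtain ⟨hx, rfl⟩ := hx
          simp only [ne_eq, Prod.mk.injEq, and_true] at hne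
          rw [hcol]; omega
      have hνN : ∀ i j : ℕ, (i, j) ∈ ν → hookLength ν i j < N := by
        refine hookLength_lt_iff.2 fun r c hr hc => ?_
        rw [hν.2, hcol, Prod.mk.injEq] at hr
        rw [hν.2, hrow, Prod.mk.injEq] at hc
        omega
      have hρN : ∀ i j : ℕ, (i, j) ∈ ρ → hookLength ρ i j < N := by
        refine hookLength_lt_iff.2 fun r c hr hc => ?_
        rw [hρ.2, hcol, Prod.mk.injEq] at hr
        rw [hρ.2, hrow, Prod.mk.injEq] at hc
        omega
      have heq := huniq ⟨ν, hνN⟩ ⟨ρ, hρN⟩ (hasseYN_adj_iff.2 ⟨_, Or.inl hν⟩)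
        (hasseYN_adj_iff.2 ⟨_, Or.inl hρ⟩)
      have hνρ : ν = ρ := congrArg Subtype.val heq
      have h1 := hν.mem
      rw [hνρ, hρ.2, hrow, Prod.mk.injEq] at h1
      omega
    · refine ⟨a, by omega, by omega, ?_⟩
      by_contra hne
      have hlast : (l - 1, a - 1) ∉ μ.1 := by
        intro hlast
        apply hne
        ext ⟨x, y⟩
        rw [YoungDiagram.mem_cells, YoungDiagram.mem_cells, mem_rect]
        constructor
        · intro h
          have := hle h
          omega
        · intro h
          exact μ.1.up_left_mem (by omega) (by omega) hlast
      -- One removable corner lies in the last column and one in the last row. If they coincide, the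
      -- box `(l - 1, a - 1)` is in `μ`, which makes `μ` a full rectangle.
      obtain ⟨⟨r, c⟩, ν, hb, hν⟩ : ∃ b ν, b ∉ rect l (a - 1) ∧ AddsBox ν μ.1 b := by
        refine exists_addsBox_of_not_le fun h => ?_
        have := h ((hrow (a - 1)).2 (by omega))
        rw [mem_rect] at this
        omega
      obtain ⟨⟨r', c'⟩, ρ, hb', hρ⟩ : ∃ b ρ, b ∉ rect (l - 1) a ∧ AddsBox ρ μ.1 b := by
        refine exists_addsBox_of_not_le fun h => ?_
        have := h ((hcol (l - 1)).2 (by omega))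
        rw [mem_rect] at this
        omega
      have heq := huniq ⟨ν, hookLength_lt_of_le μ hν.le⟩ ⟨ρ, hookLength_lt_of_le μ hρ.le⟩
        (hasseYN_adj_iff.2 ⟨_, Or.inr hν⟩) (hasseYN_adj_iff.2 ⟨_, Or.inr hρ⟩)
      have hνρ : ν = ρ := congrArg Subtype.val heq
      have hbb : (r, c) = (r', c') := by
        rcases (hρ.2 (r, c)).1 hν.mem with h | h
        · exact h
        · rw [← hνρ] at h
          exact absurd h hν.1
      rw [Prod.mk.injEq] at hbb
      obtain ⟨rfl, rfl⟩ := hbb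
      have h1 := hle hν.mem
      rw [mem_rect] at hb hb'
      obtain rfl : r = l - 1 := by omega
      obtain rfl : c = a - 1 := by omega
      exact hlast hν.mem
  · rintro (h | ⟨j, h1, h2, h⟩)
    · exact bot_mem_pendantVertices hN h
    · exact rect_mem_pendantVertices h1 h2 h

/-- The point of `X_N` given by the rectangle `(j^(N-j))`; for `j = 0` and for `j = N` it is the
empty partition. -/
def rectPoint {N : ℕ} (hN : 2 ≤ N) (j : ℕ) (hj : j ≤ N) : XN N :=
  ⟨⟨rect (N - j) j, rect_mem_YN hj⟩, (mem_pendantVertices_iff hN _).2 <| by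
    by_cases h0 : j = 0
    · subst h0; exact Or.inl (rect_zero _)
    · by_cases h1 : j = N
      · subst h1; exact Or.inl (by simpa using rect_zero_left j)
      · exact Or.inr ⟨j, by omega, by omega, rfl⟩⟩

theorem mem_rectPoint {N : ℕ} (hN : 2 ≤ N) {j : ℕ} (hj : j ≤ N) {a b : ℕ} :
    (a, b) ∈ (rectPoint hN j hj).1.1 ↔ a < N - j ∧ b < j := mem_rect

theorem exists_eq_rectPoint {N : ℕ} (hN : 2 ≤ N) (x : XN N) :
    ∃ (j : ℕ) (hj : j < N), x = rectPoint hN j hj.le := by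
  rcases (mem_pendantVertices_iff hN x.1).1 x.2 with h | ⟨j, h1, h2, h⟩
  · exact ⟨0, by omega, Subtype.ext (Subtype.ext (h.trans (rect_zero _).symm))⟩
  · exact ⟨j, by omega, Subtype.ext (Subtype.ext h)⟩

theorem rectPoint_injective {N : ℕ} (hN : 2 ≤ N) {i j : ℕ} (hi : i < N) (hj : j < N)
    (h : rectPoint hN i hi.le = rectPoint hN j hj.le) : i = j := by
  by_contra hne
  have key : ∀ k, (0, k) ∈ (rectPoint hN i hi.le).1.1 ↔ (0, k) ∈ (rectPoint hN j hj.le).1.1 :=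
    fun k => by rw [h]
  simp only [mem_rectPoint] at key
  have h1 := key i
  have h2 := key j
  omega

theorem card_XN {N : ℕ} (hN : 2 ≤ N) : Fintype.card (XN N) = N := by
  have hbij : Function.Bijective fun i : Fin N => rectPoint hN i.1 i.2.le := by
    refine ⟨fun i j h => Fin.ext (rectPoint_injective hN i.2 j.2 h), fun x => ?_⟩
    obtain ⟨j, hj, rfl⟩ := exists_eq_rectPoint hN x
    exact ⟨⟨j, hj⟩, rfl⟩
  rw [← Fintype.card_of_bijective hbij, Fintype.card_fin]

end Diagrams

/-! ### Counting in symmetric differences. -/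

section Counting

variable {α : Type*} [DecidableEq α]

theorem card_eq_sum_of_subset {S U : Finset α} (h : S ⊆ U) :
    S.card = ∑ u ∈ U, if u ∈ S then 1 else 0 := by
  rw [Finset.sum_ite_mem, Finset.inter_eq_right.2 h, Finset.card_eq_sum_ones]

theorem card_symmDiff_add_card_symmDiff (s x y : Finset α) :
    (symmDiff s x).card + (symmDiff s y).card =
      (symmDiff x y).card + 2 * ((x ∩ y) \ s).card + 2 * (s \ (x ∪ y)).card := by
  have hU : ∀ S : Finset α, (∀ u ∈ S, u ∈ s ∨ u ∈ x ∨ u ∈ y) →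
      S.card = ∑ u ∈ s ∪ x ∪ y, if u ∈ S then 1 else 0 := fun S hS =>
    card_eq_sum_of_subset fun u hu => by simpa [or_assoc] using hS u hu
  rw [hU (symmDiff s x), hU (symmDiff s y), hU (symmDiff x y), hU ((x ∩ y) \ s),
    hU (s \ (x ∪ y)), Finset.mul_sum, Finset.mul_sum, ← Finset.sum_add_distrib,
    ← Finset.sum_add_distrib, ← Finset.sum_add_distrib]
  · refine Finset.sum_congr rfl fun u _ => ?_
    by_cases h1 : u ∈ s <;> by_cases h2 : u ∈ x <;> by_cases h3 : u ∈ y <;>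
      simp [Finset.mem_symmDiff, h1, h2, h3]
  all_goals
    intro u hu
    simp only [Finset.mem_symmDiff, Finset.mem_sdiff, Finset.mem_inter, Finset.mem_union] at hu
    tauto

theorem card_symmDiff_add_eq_iff {s x y : Finset α} :
    (symmDiff s x).card + (symmDiff s y).card = (symmDiff x y).card ↔
      (∀ b, b ∈ x → b ∈ y → b ∈ s) ∧ ∀ b ∈ s, b ∈ x ∨ b ∈ y := by
  rw [card_symmDiff_add_card_symmDiff]
  have h1 : ((x ∩ y) \ s).card = 0 ↔ ∀ b, b ∈ x → b ∈ y → b ∈ s := by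
    rw [Finset.card_eq_zero, Finset.sdiff_eq_empty_iff_subset]
    simp [Finset.subset_iff]
  have h2 : (s \ (x ∪ y)).card = 0 ↔ ∀ b ∈ s, b ∈ x ∨ b ∈ y := by
    rw [Finset.card_eq_zero, Finset.sdiff_eq_empty_iff_subset]
    simp [Finset.subset_iff]
  rw [← h1, ← h2]
  omega

/-- If the pairing `xy, x'y'` is at least as long as `xy', yx'`, and some element separates
`x, y` from `x', y'`, then some element separates `x, y'` from `y, x'`. -/
theorem exists_separating {x y x' y' : Finset α} {b : α} (hx : b ∈ x) (hy : b ∈ y) (hx' : b ∉ x')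
    (hy' : b ∉ y') (h : (symmDiff x y').card + (symmDiff y x').card ≤
      (symmDiff x y).card + (symmDiff x' y').card) :
    ∃ a, (a ∈ x ∧ a ∈ y' ∧ a ∉ y ∧ a ∉ x') ∨ (a ∉ x ∧ a ∉ y' ∧ a ∈ y ∧ a ∈ x') := by
  by_contra! hcon
  have hU : ∀ S : Finset α, (∀ u ∈ S, u ∈ x ∨ u ∈ y ∨ u ∈ x' ∨ u ∈ y') →
      S.card = ∑ u ∈ x ∪ y ∪ x' ∪ y', if u ∈ S then 1 else 0 := fun S hS =>
    card_eq_sum_of_subset fun u hu => by simpa [or_assoc] using hS u hu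
  rw [hU (symmDiff x y'), hU (symmDiff y x'), hU (symmDiff x y), hU (symmDiff x' y'),
    ← Finset.sum_add_distrib, ← Finset.sum_add_distrib] at h
  · refine h.not_gt (Finset.sum_lt_sum (fun u _ => ?_) ⟨b, by simp [hx], ?_⟩)
    · have := hcon u
      by_cases h1 : u ∈ x <;> by_cases h2 : u ∈ y <;> by_cases h3 : u ∈ x' <;>
        by_cases h4 : u ∈ y' <;> simp [h1, h2, h3, h4, Finset.mem_symmDiff] at this ⊢
    · simp [hx, hy, hx', hy', Finset.mem_symmDiff]
  all_goals
    intro u hu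
    simp only [Finset.mem_symmDiff] at hu
    tauto

end Counting

/-! ### Partitions as points of the hull, and their tight pairs. -/

section HullPoint

variable {N : ℕ}

theorem dX_eq (x y : XN N) : dX N x y = (boxDist x.1.1 y.1.1 : ℝ) := by
  rw [dX, dist_hasseYN]

theorem dX_comm (x y : XN N) : dX N x y = dX N y x := by
  rw [dX_eq, dX_eq, boxDist_comm]

/-- The point of the injective hull that represents a partition: its distances to `X_N`. -/
def hullPoint (μ : YN N) : XN N → ℝ := fun x => (boxDist μ.1 x.1.1 : ℝ)

theorem hullPoint_mem_polyhedron (μ : YN N) : hullPoint μ ∈ polyhedron (dX N) := by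
  intro x y
  have := boxDist_triangle x.1.1 μ.1 y.1.1
  rw [boxDist_comm x.1.1 μ.1] at this
  rw [dX_eq, hullPoint, hullPoint]
  exact_mod_cast this

/-- A constraint `x, y` is tight at a partition iff the latter lies between `x ⊓ y` and `x ⊔ y`. -/
theorem hullPoint_tight_iff {μ : YN N} {x y : XN N} :
    hullPoint μ x + hullPoint μ y = dX N x y ↔
      (∀ b, b ∈ x.1.1 → b ∈ y.1.1 → b ∈ μ.1) ∧ ∀ b ∈ μ.1, b ∈ x.1.1 ∨ b ∈ y.1.1 := by
  rw [dX_eq, hullPoint, hullPoint, ← Nat.cast_add, Nat.cast_inj]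
  exact card_symmDiff_add_eq_iff (s := μ.1.cells) (x := x.1.1.cells) (y := y.1.1.cells)

/-- A counterexample `b` splits the four points as `xy | x'y'`. Two tight pairs are together at
least as long as either re-pairing, so `exists_separating` yields boxes realizing the other two
splittings as well. Since the rectangles through a box `(r, c)` have indices in the interval `c < j
< N - r`, the three splittings are incompatible. -/
theorem mem_or_mem_of_tight (hN : 2 ≤ N) {f : XN N → ℝ} (hf : f ∈ polyhedron (dX N))
    {x y x' y' : XN N} (h : f x + f y = dX N x y) (h' : f x' + f y' = dX N x' y') {b : ℕ × ℕ}
    (hx : b ∈ x.1.1) (hy : b ∈ y.1.1) : b ∈ x'.1.1 ∨ b ∈ y'.1.1 := by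
  by_contra! hcon
  have key1 : boxDist x.1.1 y'.1.1 + boxDist y.1.1 x'.1.1 ≤
      boxDist x.1.1 y.1.1 + boxDist x'.1.1 y'.1.1 := by
    have h1 := hf x y'
    have h2 := hf y x'
    rw [dX_eq] at h1 h2 h h'
    have : (boxDist x.1.1 y'.1.1 : ℝ) + boxDist y.1.1 x'.1.1 ≤
      boxDist x.1.1 y.1.1 + boxDist x'.1.1 y'.1.1 := by linarith
    exact_mod_cast this
  have key2 : boxDist x.1.1 x'.1.1 + boxDist y.1.1 y'.1.1 ≤
      boxDist x.1.1 y.1.1 + boxDist y'.1.1 x'.1.1 := by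
    have h1 := hf x x'
    have h2 := hf y y'
    rw [dX_comm] at h'
    rw [dX_eq] at h1 h2 h h'
    have : (boxDist x.1.1 x'.1.1 : ℝ) + boxDist y.1.1 y'.1.1 ≤
      boxDist x.1.1 y.1.1 + boxDist y'.1.1 x'.1.1 := by linarith
    exact_mod_cast this
  obtain ⟨⟨r₁, c₁⟩, h1⟩ := exists_separating (x := x.1.1.cells) (y := y.1.1.cells)
    (x' := x'.1.1.cells) (y' := y'.1.1.cells) hx hy hcon.1 hcon.2 key1
  obtain ⟨⟨r₂, c₂⟩, h2⟩ := exists_separating (x := x.1.1.cells) (y := y.1.1.cells)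
    (x' := y'.1.1.cells) (y' := x'.1.1.cells) hx hy hcon.2 hcon.1 key2
  obtain ⟨i, hi, rfl⟩ := exists_eq_rectPoint hN x
  obtain ⟨j, hj, rfl⟩ := exists_eq_rectPoint hN y
  obtain ⟨k, hk, rfl⟩ := exists_eq_rectPoint hN x'
  obtain ⟨l, hl, rfl⟩ := exists_eq_rectPoint hN y'
  obtain ⟨r, c⟩ := b
  simp only [YoungDiagram.mem_cells, mem_rectPoint] at *
  clear key1 key2 h h'
  omega

/-- Every point of the polyhedron has a partition in its tight face. -/
theorem exists_hullPoint_mem_tightFace (hN : 2 ≤ N) {f : XN N → ℝ}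
    (hf : f ∈ polyhedron (dX N)) : ∃ μ : YN N, hullPoint μ ∈ tightFace (dX N) f := by
  classical
  let μ : YoungDiagram :=
    { cells := (Finset.range N ×ˢ Finset.range N).filter fun b =>
        ∃ x y : XN N, f x + f y = dX N x y ∧ b ∈ x.1.1 ∧ b ∈ y.1.1
      isLowerSet := by
        rintro ⟨r, c⟩ ⟨r', c'⟩ hle h
        simp only [Finset.coe_filter, Finset.mem_product, Finset.mem_range,
          Set.mem_ofPred_eq] at h ⊢
        obtain ⟨h1, x, y, hxy, hx, hy⟩ := h
        have h2 := Prod.mk_le_mk.1 hle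
        exact ⟨by omega, x, y, hxy, x.1.1.up_left_mem h2.1 h2.2 hx,
          y.1.1.up_left_mem h2.1 h2.2 hy⟩ }
  have hμ : ∀ b, b ∈ μ ↔ ∃ x y : XN N, f x + f y = dX N x y ∧ b ∈ x.1.1 ∧ b ∈ y.1.1 := by
    intro b
    rw [← YoungDiagram.mem_cells]
    simp only [μ, Finset.mem_filter, Finset.mem_product, Finset.mem_range, and_iff_right_iff_imp]
    rintro ⟨x, y, -, hx, -⟩
    exact lt_of_mem_YN x.1 hx
  -- The box `(0, c)` lies in one of the two rectangles that both contain `(r, 0)`; that rectangle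
  -- satisfies the hook bound.
  have hμN : ∀ i j : ℕ, (i, j) ∈ μ → hookLength μ i j < N := by
    refine hookLength_lt_iff.2 fun r c hr hc => ?_
    rw [hμ] at hr hc
    obtain ⟨x, y, hxy, hx, hy⟩ := hr
    obtain ⟨x', y', hxy', hx', hy'⟩ := hc
    rcases mem_or_mem_of_tight hN hf hxy' hxy hx' hy' with h | h
    · exact add_le_of_mem x.1 hx h
    · exact add_le_of_mem y.1 hy h
  refine ⟨⟨μ, hμN⟩, hullPoint_mem_polyhedron _, fun x y hxy => hullPoint_tight_iff.2 ⟨?_, ?_⟩⟩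
  · intro b hx hy
    exact (hμ b).2 ⟨x, y, hxy, hx, hy⟩
  · intro b hb
    obtain ⟨x', y', hxy', hx', hy'⟩ := (hμ b).1 hb
    exact mem_or_mem_of_tight hN hf hxy' hxy hx' hy'

/-- Removing a corner loses a tight pair of boundary points that both contain it. -/
theorem exists_tight_pair_mem (hN : 2 ≤ N) {μ : YN N} {ν : YoungDiagram} {b : ℕ × ℕ}
    (h : AddsBox ν μ.1 b) : ∃ x y : XN N, b ∈ x.1.1 ∧ b ∈ y.1.1 ∧
      hullPoint μ x + hullPoint μ y = dX N x y := by
  obtain ⟨r, c⟩ := b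
  have hrc := add_le_of_mem μ h.mem h.mem
  -- These are the extreme indices of rectangles containing `(r, c)`; they intersect exactly in the
  -- boxes weakly before `(r, c)`.
  refine ⟨rectPoint hN (c + 1) (by omega), rectPoint hN (N - 1 - r) (by omega), ?_, ?_,
    hullPoint_tight_iff.2 ⟨?_, ?_⟩⟩
  · rw [mem_rectPoint]; omega
  · rw [mem_rectPoint]; omega
  · rintro ⟨r', c'⟩ h1 h2
    rw [mem_rectPoint] at h1 h2
    exact μ.1.up_left_mem (by omega) (by omega) h.mem
  · rintro ⟨r', c'⟩ h1
    rw [mem_rectPoint, mem_rectPoint]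
    have h2 := add_le_of_mem μ h1 h.mem
    have h3 := add_le_of_mem μ h.mem h1
    by_cases h4 : r ≤ r' ∧ c ≤ c'
    · have := h.eq_of_le h1 h4.1 h4.2
      rw [Prod.mk.injEq] at this
      omega
    · omega

theorem rectPoint_zero_eq (hN : 2 ≤ N) :
    rectPoint hN 0 (Nat.zero_le N) = rectPoint hN N le_rfl := by
  apply Subtype.ext
  apply Subtype.ext
  apply YoungDiagram.ext
  ext ⟨a, b⟩
  rw [YoungDiagram.mem_cells, YoungDiagram.mem_cells, mem_rectPoint, mem_rectPoint]
  omega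

/-- Adding a box loses exactly one tight pair of boundary points. -/
theorem exists_tight_pair_notMem (hN : 2 ≤ N) {ν μ : YN N} {b : ℕ × ℕ}
    (h : AddsBox ν.1 μ.1 b) : ∃ x y : XN N, b ∉ x.1.1 ∧ b ∉ y.1.1 ∧
      hullPoint ν x + hullPoint ν y = dX N x y ∧
      ∀ u v : XN N, hullPoint ν u + hullPoint ν v = dX N u v → b ∉ u.1.1 → b ∉ v.1.1 →
        (u = x ∧ v = y) ∨ (u = y ∧ v = x) := by
  obtain ⟨r, c⟩ := b
  have hrc := add_le_of_mem μ h.mem h.mem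
  have hmono : ∀ {a b}, (a, b) ∈ ν.1 → a + c + 2 ≤ N ∧ r + b + 2 ≤ N := fun h1 =>
    ⟨add_le_of_mem μ (h.le h1) h.mem, add_le_of_mem μ h.mem (h.le h1)⟩
  -- These are the indices just outside the interval of rectangles containing `(r, c)`. For `c = 0`
  -- or `r = 0` the corresponding one is the empty partition.
  refine ⟨rectPoint hN c (by omega), rectPoint hN (N - r) (by omega), ?_, ?_,
    hullPoint_tight_iff.2 ⟨?_, ?_⟩, ?_⟩
  · rw [mem_rectPoint]; omega
  · rw [mem_rectPoint]; omega
  · rintro ⟨r', c'⟩ h1 h2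
    rw [mem_rectPoint] at h1 h2
    rcases (h.2 (r', c')).1 (μ.1.up_left_mem (by omega) (by omega) h.mem) with h3 | h3
    · rw [Prod.mk.injEq] at h3
      omega
    · exact h3
  · rintro ⟨r', c'⟩ h1
    rw [mem_rectPoint, mem_rectPoint]
    have h2 := hmono h1
    by_cases h4 : r ≤ r' ∧ c ≤ c'
    · have := h.eq_of_le (h.le h1) h4.1 h4.2
      rw [this] at h1
      exact absurd h1 h.1
    · omega
  · have hcol : 0 < c → (r, c - 1) ∈ ν.1 := fun hc => by
      rcases (h.2 (r, c - 1)).1 (μ.1.up_left_mem le_rfl (by omega) h.mem) with h3 | h3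
      · rw [Prod.mk.injEq] at h3
        omega
      · exact h3
    have hrow : 0 < r → (r - 1, c) ∈ ν.1 := fun hr => by
      rcases (h.2 (r - 1, c)).1 (μ.1.up_left_mem (by omega) le_rfl h.mem) with h3 | h3
      · rw [Prod.mk.injEq] at h3
        omega
      · exact h3
    -- Indices of boundary points are normalized to be below `N`, so for `r = 0` the index `N - r`
    -- shows up as `0`.
    have aux : ∀ i j : ℕ, i < N → j < N → (i = c ∧ (j = N - r ∨ j = 0 ∧ r = 0)) →
        ∀ (hi : i ≤ N) (hj : j ≤ N), rectPoint hN i hi = rectPoint hN c (by omega) ∧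
          rectPoint hN j hj = rectPoint hN (N - r) (by omega) := by
      rintro i j - - ⟨rfl, rfl | ⟨rfl, rfl⟩⟩ hi hj
      · exact ⟨rfl, rfl⟩
      · exact ⟨rfl, rectPoint_zero_eq hN⟩
    intro u v huv hu hv
    obtain ⟨i, hi, rfl⟩ := exists_eq_rectPoint hN u
    obtain ⟨j, hj, rfl⟩ := exists_eq_rectPoint hN v
    rw [hullPoint_tight_iff] at huv
    obtain ⟨hinf, hsup⟩ := huv
    -- A rectangle that contains `(r, c - 1)` but not `(r, c)` has index `c`, and one that contains
    -- `(r - 1, c)` but not `(r, c)` has index `N - r`. The two corner boxes of the intersection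
    -- tested below settle the cases `c = 0` and `r = 0`.
    have hcol' := fun hc => hsup _ (hcol hc)
    have hrow' := fun hr => hsup _ (hrow hr)
    have hinf1 := hinf (0, min i j - 1)
    have hinf2 := hinf (N - max i j - 1, 0)
    simp only [mem_rectPoint] at hu hv hcol' hrow' hinf1 hinf2
    have hb1 : 0 < i → 0 < j → r + (min i j - 1) + 2 ≤ N ∧ N - max i j - 1 + c + 2 ≤ N := by
      intro h1 h2
      exact ⟨(hmono (hinf1 (by omega) (by omega))).2, (hmono (hinf2 (by omega) (by omega))).1⟩
    have hcases : (i = c ∧ (j = N - r ∨ j = 0 ∧ r = 0)) ∨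
        (j = c ∧ (i = N - r ∨ i = 0 ∧ r = 0)) := by
      clear hinf1 hinf2 hinf hsup hmono hcol hrow aux
      omega
    rcases hcases with h1 | h1
    · exact Or.inl (aux i j hi hj h1 _ _)
    · exact Or.inr (aux j i hj hi h1 _ _).symm

/-! ### Box directions, and partitions as vertices. -/

open Classical in
/-- The direction in which `hullPoint` moves when the box `b` is removed. -/
noncomputable def boxSign (b : ℕ × ℕ) : XN N → ℝ := fun x => if b ∈ x.1.1 then 1 else -1

theorem boxSign_of_mem {b : ℕ × ℕ} {x : XN N} (h : b ∈ x.1.1) : boxSign b x = 1 := if_pos h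

theorem boxSign_of_notMem {b : ℕ × ℕ} {x : XN N} (h : b ∉ x.1.1) : boxSign b x = -1 := if_neg h

theorem boxSign_ne_zero (b : ℕ × ℕ) (x : XN N) : boxSign b x ≠ 0 := by
  unfold boxSign
  split_ifs <;> norm_num

theorem hullPoint_eq_add_boxSign {ν μ : YN N} {b : ℕ × ℕ} (h : AddsBox ν.1 μ.1 b) (x : XN N) :
    hullPoint ν x = hullPoint μ x + boxSign b x := by
  unfold hullPoint
  by_cases hb : b ∈ x.1.1
  · rw [boxSign_of_mem hb, h.boxDist_of_mem hb]
    push_cast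
    ring
  · rw [boxSign_of_notMem hb, h.boxDist_of_notMem hb]
    push_cast
    ring

theorem boxSign_add_boxSign {b : ℕ × ℕ} {x y : XN N} (h : b ∈ x.1.1 ∨ b ∈ y.1.1)
    (h' : ¬ (b ∈ x.1.1 ∧ b ∈ y.1.1)) : (boxSign b x + boxSign b y : ℝ) = 0 := by
  by_cases hx : b ∈ x.1.1
  · rw [boxSign_of_mem hx, boxSign_of_notMem fun hy => h' ⟨hx, hy⟩]
    norm_num
  · rw [boxSign_of_notMem hx, boxSign_of_mem (h.resolve_left hx)]
    norm_num

/-- The hypothesis on `v` covers all tight pairs of `ν` except the one pair lost when adding `b`.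
There `boxSign b` sums to `-2`, elsewhere to `0`, so adding `(v x + v y) / 2` times `boxSign b`
gives a tight direction at `ν`, which must vanish. -/
theorem eq_smul_boxSign (hN : 2 ≤ N) {ν μ : YN N} {b : ℕ × ℕ} (h : AddsBox ν.1 μ.1 b)
    (hν : ∀ w, IsTightDir (dX N) (hullPoint ν) w → w = 0) {v : XN N → ℝ}
    (hv : ∀ x y, hullPoint ν x + hullPoint ν y = dX N x y →
      hullPoint μ x + hullPoint μ y = dX N x y → v x + v y = 0) :
    ∃ t : ℝ, v = t • boxSign b := by
  obtain ⟨x, y, hx, hy, -, huniq⟩ := exists_tight_pair_notMem hN h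
  have hw := hν (v + ((v x + v y) / 2) • boxSign b) ?_
  · exact ⟨-((v x + v y) / 2), by rw [neg_smul]; exact eq_neg_of_add_eq_zero_left hw⟩
  · intro u w huw
    simp only [Pi.add_apply, Pi.smul_apply, smul_eq_mul]
    by_cases hb : b ∈ u.1.1 ∨ b ∈ w.1.1
    · have h1 := hullPoint_tight_iff.1 huw
      have h2 : hullPoint μ u + hullPoint μ w = dX N u w := by
        refine hullPoint_tight_iff.2 ⟨fun a ha ha' => h.le (h1.1 a ha ha'), fun a ha => ?_⟩
        rcases (h.2 a).1 ha with rfl | h3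
        · exact hb
        · exact h1.2 a h3
      have h3 := boxSign_add_boxSign hb fun h3 => h.1 (h1.1 b h3.1 h3.2)
      linear_combination hv u w huw h2 + ((v x + v y) / 2) * h3
    · rw [not_or] at hb
      rw [boxSign_of_notMem hb.1, boxSign_of_notMem hb.2]
      rcases huniq u w huw hb.1 hb.2 with ⟨rfl, rfl⟩ | ⟨rfl, rfl⟩ <;> ring

/-- The tight constraints at a partition determine a single point. -/
theorem isTightDir_hullPoint_eq_zero (hN : 2 ≤ N) (μ : YN N) :
    ∀ v, IsTightDir (dX N) (hullPoint μ) v → v = 0 := by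
  induction μ using WellFoundedLT.induction with
  | ind μ ih =>
    intro v hv
    by_cases hbot : μ.1 ≤ ⊥
    · have h0 : ∀ y, v (rectPoint hN 0 (Nat.zero_le N)) + v y = 0 := by
        intro y
        refine hv _ _ (hullPoint_tight_iff.2 ⟨?_, ?_⟩)
        · rintro ⟨a, b⟩ h1 -
          rw [mem_rectPoint] at h1
          omega
        · intro b hb
          exact absurd (hbot hb) (YoungDiagram.notMem_bot _)
      funext y
      have h1 := h0 (rectPoint hN 0 (Nat.zero_le N))
      have h2 := h0 y
      simp only [Pi.zero_apply]
      linarith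
    · obtain ⟨b, ρ, -, h⟩ := exists_addsBox_of_not_le hbot
      let ν : YN N := ⟨ρ, hookLength_lt_of_le μ h.le⟩
      have h' : AddsBox ν.1 μ.1 b := h
      have hlt : ν < μ := (covBy_iff.2 ⟨b, h'⟩).lt
      obtain ⟨t, rfl⟩ := eq_smul_boxSign hN h' (ih ν hlt) fun x y _ hxy => hv x y hxy
      -- A tight pair of `μ` with `b` in both members turns the remaining freedom into `2 * t = 0`.
      obtain ⟨x, y, hx, hy, hxy⟩ := exists_tight_pair_mem hN h
      have h1 := hv x y hxy
      simp only [Pi.smul_apply, smul_eq_mul, boxSign_of_mem hx, boxSign_of_mem hy] at h1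
      have : t = 0 := by linarith
      simp [this]

theorem hullPoint_injective (hN : 2 ≤ N) : Function.Injective (hullPoint (N := N)) := by
  have key : ∀ μ ν : YN N, hullPoint μ = hullPoint ν → μ.1 ≤ ν.1 := by
    intro μ ν h
    by_contra hle
    obtain ⟨b, ρ, hb, hρ⟩ := exists_addsBox_of_not_le hle
    obtain ⟨x, y, hx, hy, hxy⟩ := exists_tight_pair_mem hN hρ
    rw [h] at hxy
    exact hb ((hullPoint_tight_iff.1 hxy).1 b hx hy)
  exact fun μ ν h => Subtype.ext (le_antisymm (key μ ν h) (key ν μ h.symm))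

end HullPoint

/-! ### The faces of dimension zero and one. -/

section Skeleton

variable {N : ℕ}

theorem not_isTightDir_single_of_eq_smul [DecidableEq (XN N)] (hN : 2 ≤ N) {b : ℕ × ℕ} {t : ℝ}
    {x : XN N} (h : (Pi.single x 1 : XN N → ℝ) = t • boxSign b) : False := by
  obtain ⟨y, hy⟩ : ∃ y, y ≠ x := by
    have : 1 < Fintype.card (XN N) := by rw [card_XN hN]; omega
    have := Fintype.one_lt_card_iff_nontrivial.1 this
    exact exists_ne x
  have h1 := congrFun h y
  have h2 := congrFun h x
  rw [Pi.single_eq_of_ne hy, Pi.smul_apply, smul_eq_mul, eq_comm, mul_eq_zero] at h1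
  rw [h1.resolve_right (boxSign_ne_zero b y)] at h2
  simp at h2

theorem hullPoint_mem_injHull (hN : 2 ≤ N) (μ : YN N) : hullPoint μ ∈ injHull (dX N) := by
  classical
  refine mem_injHull_of_isTightDir_single dX_comm (hullPoint_mem_polyhedron μ) fun x hx => ?_
  have h := congrFun (isTightDir_hullPoint_eq_zero hN μ _ hx) x
  simp at h

theorem tightFace_hullPoint (hN : 2 ≤ N) (μ : YN N) :
    tightFace (dX N) (hullPoint μ) = {hullPoint μ} := by
  have hmem := self_mem_tightFace (hullPoint_mem_polyhedron μ)
  refine Set.eq_singleton_iff_unique_mem.2 ⟨hmem, fun g hg => ?_⟩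
  exact sub_eq_zero.1 (isTightDir_hullPoint_eq_zero hN μ _ (isTightDir_sub hg hmem))

/-- The midpoint of the edge between two partitions. -/
noncomputable def edgeMid (ν μ : YN N) : XN N → ℝ :=
  (1 / 2 : ℝ) • hullPoint ν + (1 / 2 : ℝ) • hullPoint μ

theorem edgeMid_tight_iff {ν μ : YN N} {x y : XN N} :
    edgeMid ν μ x + edgeMid ν μ y = dX N x y ↔
      hullPoint ν x + hullPoint ν y = dX N x y ∧ hullPoint μ x + hullPoint μ y = dX N x y :=
  midpoint_tight (hullPoint_mem_polyhedron ν) (hullPoint_mem_polyhedron μ)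
    (by norm_num) (by norm_num) (by norm_num)

theorem hullPoint_left_mem_tightFace (ν μ : YN N) :
    hullPoint ν ∈ tightFace (dX N) (edgeMid ν μ) :=
  ⟨hullPoint_mem_polyhedron ν, fun _ _ h => (edgeMid_tight_iff.1 h).1⟩

theorem hullPoint_right_mem_tightFace (ν μ : YN N) :
    hullPoint μ ∈ tightFace (dX N) (edgeMid ν μ) :=
  ⟨hullPoint_mem_polyhedron μ, fun _ _ h => (edgeMid_tight_iff.1 h).2⟩

theorem edgeMid_mem_polyhedron (ν μ : YN N) : edgeMid ν μ ∈ polyhedron (dX N) :=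
  (convex_tightFace (dX N) (edgeMid ν μ) (hullPoint_left_mem_tightFace ν μ)
    (hullPoint_right_mem_tightFace ν μ) (by norm_num) (by norm_num) (by norm_num)).1

theorem edgeMid_comm (ν μ : YN N) : edgeMid ν μ = edgeMid μ ν := add_comm _ _

theorem isTightDir_edgeMid (hN : 2 ≤ N) {ν μ : YN N} {b : ℕ × ℕ} (h : AddsBox ν.1 μ.1 b)
    {v : XN N → ℝ} (hv : IsTightDir (dX N) (edgeMid ν μ) v) : ∃ t : ℝ, v = t • boxSign b :=
  eq_smul_boxSign hN h (isTightDir_hullPoint_eq_zero hN ν) fun x y h1 h2 =>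
    hv x y (edgeMid_tight_iff.2 ⟨h1, h2⟩)

theorem edgeMid_mem_injHull (hN : 2 ≤ N) {ν μ : YN N} (h : (hasseYN N).Adj ν μ) :
    edgeMid ν μ ∈ injHull (dX N) := by
  classical
  refine mem_injHull_of_isTightDir_single dX_comm (edgeMid_mem_polyhedron ν μ) fun x hx => ?_
  obtain ⟨b, hb | hb⟩ := hasseYN_adj_iff.1 h
  · obtain ⟨t, ht⟩ := isTightDir_edgeMid hN hb hx
    exact not_isTightDir_single_of_eq_smul hN ht
  · rw [edgeMid_comm] at hx
    obtain ⟨t, ht⟩ := isTightDir_edgeMid hN hb hx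
    exact not_isTightDir_single_of_eq_smul hN ht

/-- The tight face of the midpoint of an edge is the edge. -/
theorem tightFace_edgeMid (hN : 2 ≤ N) {ν μ : YN N} (h : (hasseYN N).Adj ν μ) :
    tightFace (dX N) (edgeMid ν μ) = segment ℝ (hullPoint ν) (hullPoint μ) := by
  have key : ∀ ν μ : YN N, ∀ b, AddsBox ν.1 μ.1 b →
      tightFace (dX N) (edgeMid ν μ) ⊆ segment ℝ (hullPoint ν) (hullPoint μ) := by
    intro ν μ b hb g hg
    obtain ⟨t, ht⟩ := isTightDir_edgeMid hN hb
      (isTightDir_sub hg (hullPoint_left_mem_tightFace ν μ))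
    have hg' : ∀ z, g z = hullPoint ν z + t * boxSign b z := fun z => by
      have := congrFun ht z
      simp only [Pi.sub_apply, Pi.smul_apply, smul_eq_mul] at this
      linarith
    -- The pair lost by removing `b` gives `-1 ≤ t`, the pair lost by adding it gives `t ≤ 0`.
    obtain ⟨x, y, hx, hy, hxy⟩ := exists_tight_pair_mem hN hb
    obtain ⟨x', y', hx', hy', hxy', -⟩ := exists_tight_pair_notMem hN hb
    have h1 := hg.1 x y
    have h2 := hg.1 x' y'
    rw [hg', hg', hullPoint_eq_add_boxSign hb, hullPoint_eq_add_boxSign hb, boxSign_of_mem hx,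
      boxSign_of_mem hy] at h1
    rw [hg', hg', boxSign_of_notMem hx', boxSign_of_notMem hy'] at h2
    refine ⟨1 + t, -t, by linarith, by linarith, by ring, ?_⟩
    funext z
    simp only [Pi.add_apply, Pi.smul_apply, smul_eq_mul]
    rw [hg', hullPoint_eq_add_boxSign hb]
    ring
  refine Set.Subset.antisymm ?_ ((convex_tightFace _ _).segment_subset
    (hullPoint_left_mem_tightFace ν μ) (hullPoint_right_mem_tightFace ν μ))
  obtain ⟨b, hb | hb⟩ := hasseYN_adj_iff.1 h
  · exact key ν μ b hb
  · rw [edgeMid_comm, segment_symm]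
    exact key μ ν b hb

theorem dist_hullPoint_of_adj (hN : 2 ≤ N) {ν μ : YN N} (h : (hasseYN N).Adj ν μ) :
    dist (hullPoint ν) (hullPoint μ) = 1 := by
  have key : ∀ ν μ : YN N, ∀ b, AddsBox ν.1 μ.1 b → dist (hullPoint ν) (hullPoint μ) = 1 := by
    intro ν μ b hb
    have hx : ∀ x, dist (hullPoint ν x) (hullPoint μ x) = 1 := by
      intro x
      rw [hullPoint_eq_add_boxSign hb, dist_self_add_left, boxSign]
      split_ifs <;> simp
    refine le_antisymm ((dist_pi_le_iff zero_le_one).2 fun x => (hx x).le) ?_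
    rw [← hx (rectPoint hN 0 (Nat.zero_le N))]
    exact dist_le_pi_dist _ _ _
  obtain ⟨b, hb | hb⟩ := hasseYN_adj_iff.1 h
  · exact key ν μ b hb
  · rw [dist_comm]
    exact key μ ν b hb

/-- Tightness at `ν` forbids `b` in both members of a tight pair, and tightness at `μ` forbids it in
neither, so the signs cancel. -/
theorem isTightDir_boxSign {f : XN N → ℝ} {ν μ : YN N} {b : ℕ × ℕ}
    (hν : hullPoint ν ∈ tightFace (dX N) f) (hμ : hullPoint μ ∈ tightFace (dX N) f)
    (hb : b ∉ ν.1) (hb' : b ∈ μ.1) : IsTightDir (dX N) f (boxSign b) := by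
  intro x y hxy
  have h1 := (hullPoint_tight_iff.1 (hν.2 x y hxy)).1 b
  exact boxSign_add_boxSign ((hullPoint_tight_iff.1 (hμ.2 x y hxy)).2 b hb')
    fun h => hb (h1 h.1 h.2)

theorem boxSign_injective (hN : 2 ≤ N) {μ μ' : YN N} {b b' : ℕ × ℕ} (hb : b ∈ μ.1)
    (hb' : b' ∈ μ'.1) (h : (boxSign b : XN N → ℝ) = boxSign b') : b = b' := by
  have hiff : ∀ x : XN N, b ∈ x.1.1 ↔ b' ∈ x.1.1 := by
    intro x
    have := congrFun h x
    unfold boxSign at this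
    split_ifs at this with h1 h2 h2
    · simp [h1, h2]
    · norm_num at this
    · norm_num at this
    · simp [h1, h2]
  obtain ⟨r, c⟩ := b
  obtain ⟨r', c'⟩ := b'
  have h1 := add_le_of_mem μ hb hb
  have h2 := add_le_of_mem μ' hb' hb'
  have h3 := hiff (rectPoint hN (c + 1) (by omega))
  have h4 := hiff (rectPoint hN (N - 1 - r) (by omega))
  have h5 := hiff (rectPoint hN (c' + 1) (by omega))
  have h6 := hiff (rectPoint hN (N - 1 - r') (by omega))
  simp only [mem_rectPoint] at h3 h4 h5 h6
  rw [Prod.mk.injEq]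
  omega

/-- Two different partitions in a common one-dimensional face are adjacent. -/
theorem adj_of_finrank_eq_one (hN : 2 ≤ N) {f : XN N → ℝ} (hf : f ∈ polyhedron (dX N))
    (hdim : Module.finrank ℝ (vectorSpan ℝ (tightFace (dX N) f)) = 1) {ν μ : YN N}
    (hν : hullPoint ν ∈ tightFace (dX N) f) (hμ : hullPoint μ ∈ tightFace (dX N) f)
    (hne : ν ≠ μ) : (hasseYN N).Adj ν μ := by
  -- On a line two such directions are proportional, and both equal `-1` at the empty partition.
  have huniq : ∀ b b' : ℕ × ℕ, boxSign b ∈ vectorSpan ℝ (tightFace (dX N) f) →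
      boxSign b' ∈ vectorSpan ℝ (tightFace (dX N) f) →
      (boxSign b : XN N → ℝ) = boxSign b' := by
    intro b b' hb hb'
    have hnz : (⟨boxSign b, hb⟩ : vectorSpan ℝ (tightFace (dX N) f)) ≠ 0 := by
      intro h
      have := congrFun (congrArg Subtype.val h) (rectPoint hN 0 (Nat.zero_le N))
      exact boxSign_ne_zero _ _ this
    obtain ⟨t, ht⟩ := (finrank_eq_one_iff_of_nonzero' _ hnz).1 hdim ⟨_, hb'⟩
    have ht' : t • boxSign b = boxSign b' := congrArg Subtype.val ht
    have h0 := congrFun ht' (rectPoint hN 0 (Nat.zero_le N))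
    have hnot : ∀ a : ℕ × ℕ, a ∉ (rectPoint hN 0 (Nat.zero_le N)).1.1 := by
      rintro ⟨r, c⟩ h
      rw [mem_rectPoint] at h
      omega
    rw [Pi.smul_apply, smul_eq_mul, boxSign_of_notMem (hnot b), boxSign_of_notMem (hnot b')] at h0
    have : t = 1 := by linarith
    rw [← ht', this, one_smul]
  have key : ∀ ν μ : YN N, hullPoint ν ∈ tightFace (dX N) f →
      hullPoint μ ∈ tightFace (dX N) f → ¬ μ.1 ≤ ν.1 → (hasseYN N).Adj ν μ := by
    intro ν μ hν hμ hle
    obtain ⟨b, ρ, hb, hρ⟩ := exists_addsBox_of_not_le hle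
    have hbs := mem_vectorSpan_tightFace hf (isTightDir_boxSign hν hμ hb hρ.mem)
    have heq : ν.1 = ρ := by
      ext a
      rw [YoungDiagram.mem_cells, YoungDiagram.mem_cells]
      constructor
      · intro ha
        by_contra ha'
        have haμ : a ∉ μ.1 := fun h => by
          rcases (hρ.2 a).1 h with rfl | h1
          · exact hb ha
          · exact ha' h1
        have := huniq _ _ hbs (mem_vectorSpan_tightFace hf (isTightDir_boxSign hμ hν haμ ha))
        exact haμ (boxSign_injective hN hρ.mem ha this ▸ hρ.mem)
      · intro ha
        by_contra ha'
        have haμ := hρ.le ha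
        have := huniq _ _ hbs (mem_vectorSpan_tightFace hf (isTightDir_boxSign hν hμ ha' haμ))
        exact hρ.1 ((boxSign_injective hN hρ.mem haμ this).symm ▸ ha)
    exact hasseYN_adj_iff.2 ⟨b, Or.inl (heq ▸ hρ)⟩
  by_cases hle : μ.1 ≤ ν.1
  · by_cases hle' : ν.1 ≤ μ.1
    · exact absurd (Subtype.ext (le_antisymm hle' hle)) hne
    · exact (key μ ν hμ hν hle').symm
  · exact key ν μ hν hμ hle

/-- The tight face of `g` itself contains a partition, and extremality leaves no room for it to
differ from `g`. -/
theorem mem_range_hullPoint_of_mem_extremePoints (hN : 2 ≤ N) {f g : XN N → ℝ}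
    (hg : g ∈ (tightFace (dX N) f).extremePoints ℝ) : ∃ μ : YN N, g = hullPoint μ := by
  obtain ⟨μ, hμ⟩ := exists_hullPoint_mem_tightFace hN hg.1.1
  refine ⟨μ, (sub_eq_zero.1 (isTightDir_eq_zero_of_mem_extremePoints hg
    (isTightDir_sub hμ (self_mem_tightFace hg.1.1)))).symm⟩

theorem hullFacesOfDim_zero (hN : 2 ≤ N) :
    hullFacesOfDim (dX N) 0 = {F | ∃ a : YN N, F = {hullPoint a}} := by
  ext F
  constructor
  · rintro ⟨hF, hdim⟩
    obtain ⟨f, hfF, hf, rfl⟩ := exists_eq_tightFace hF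
    obtain ⟨μ, hμ⟩ := exists_hullPoint_mem_tightFace hN hf
    have hss : (tightFace (dX N) f).Subsingleton := by
      rwa [Submodule.finrank_eq_zero, vectorSpan_eq_bot_iff_subsingleton] at hdim
    exact ⟨μ, hss.eq_singleton_of_mem hμ⟩
  · rintro ⟨μ, rfl⟩
    refine ⟨?_, by rw [vectorSpan_singleton, finrank_bot]⟩
    rw [← tightFace_hullPoint hN μ]
    exact tightFace_mem_hullFaces (hullPoint_mem_injHull hN μ)

theorem hullFacesOfDim_one (hN : 2 ≤ N) :
    hullFacesOfDim (dX N) 1 = {F | ∃ a b : YN N, (hasseYN N).Adj a b ∧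
      F = segment ℝ (hullPoint a) (hullPoint b)} := by
  ext F
  constructor
  · rintro ⟨hF, hdim⟩
    obtain ⟨f, hfF, hf, rfl⟩ := exists_eq_tightFace hF
    have hns : ¬ (tightFace (dX N) f).Subsingleton := fun h => by
      rw [(vectorSpan_eq_bot_iff_subsingleton ℝ).2 h, finrank_bot] at hdim
      exact zero_ne_one hdim
    obtain ⟨g, hg, h, hh, hgh⟩ := exists_extremePoints_ne hF hns
    obtain ⟨ν, rfl⟩ := mem_range_hullPoint_of_mem_extremePoints hN hg
    obtain ⟨μ, rfl⟩ := mem_range_hullPoint_of_mem_extremePoints hN hh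
    have hadj := adj_of_finrank_eq_one hN hf hdim hg.1 hh.1 (fun h => hgh (h ▸ rfl))
    refine ⟨ν, μ, hadj, Set.Subset.antisymm (fun u hu => ?_)
      ((convex_tightFace _ _).segment_subset hg.1 hh.1)⟩
    rw [← tightFace_edgeMid hN hadj]
    have hd0 : hullPoint ν - hullPoint μ ≠ 0 := sub_ne_zero.2 hgh
    have hd : hullPoint ν - hullPoint μ ∈ vectorSpan ℝ (tightFace (dX N) f) :=
      vsub_mem_vectorSpan ℝ hg.1 hh.1
    obtain ⟨t, ht⟩ := (finrank_eq_one_iff_of_nonzero'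
      (⟨_, hd⟩ : vectorSpan ℝ (tightFace (dX N) f)) (fun h => hd0 (congrArg Subtype.val h))).1 hdim
      ⟨u - hullPoint ν, vsub_mem_vectorSpan ℝ hu hg.1⟩
    have ht' : t • (hullPoint ν - hullPoint μ) = u - hullPoint ν := congrArg Subtype.val ht
    -- A constraint tight at both partitions is tight on the whole line through them, and `u` lies
    -- on this line.
    refine ⟨hu.1, fun x y hxy => ?_⟩
    obtain ⟨h1, h2⟩ := edgeMid_tight_iff.1 hxy
    have h3 := congrFun ht' x
    have h4 := congrFun ht' y
    simp only [Pi.smul_apply, Pi.sub_apply, smul_eq_mul] at h3 h4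
    linear_combination h1 - h3 - h4 + t * (h1 - h2)
  · rintro ⟨ν, μ, hadj, rfl⟩
    constructor
    · rw [← tightFace_edgeMid hN hadj]
      exact tightFace_mem_hullFaces (edgeMid_mem_injHull hN hadj)
    · rw [← convexHull_pair, ← direction_affineSpan, affineSpan_convexHull, direction_affineSpan,
        vectorSpan_pair_rev]
      apply finrank_span_singleton
      intro h
      have h1 : hullPoint μ = hullPoint ν := by simpa [sub_eq_zero] using h
      exact hadj.ne (hullPoint_injective hN h1).symm

theorem oneSkeleton_eq (hN : 2 ≤ N) :
    oneSkeleton (dX N) = Set.range (hullPoint (N := N)) ∪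
      {f | ∃ a b : YN N, (hasseYN N).Adj a b ∧ f ∈ segment ℝ (hullPoint a) (hullPoint b)} := by
  have h0 := hullFacesOfDim_zero hN
  have h1 := hullFacesOfDim_one hN
  ext f
  constructor
  · rintro ⟨F, ⟨hF, hdim⟩, hf⟩
    rcases Nat.le_one_iff_eq_zero_or_eq_one.1 hdim with h | h
    · have : F ∈ hullFacesOfDim (dX N) 0 := ⟨hF, h⟩
      rw [h0] at this
      obtain ⟨a, rfl⟩ := this
      exact Or.inl ⟨a, hf.symm⟩
    · have : F ∈ hullFacesOfDim (dX N) 1 := ⟨hF, h⟩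
      rw [h1] at this
      obtain ⟨a, b, hab, rfl⟩ := this
      exact Or.inr ⟨a, b, hab, hf⟩
  · rintro (⟨a, rfl⟩ | ⟨a, b, hab, hf⟩)
    · have : {hullPoint a} ∈ hullFacesOfDim (dX N) 0 := by
        rw [h0]
        exact ⟨a, rfl⟩
      exact ⟨_, ⟨this.1, this.2.le.trans zero_le_one⟩, rfl⟩
    · have : segment ℝ (hullPoint a) (hullPoint b) ∈ hullFacesOfDim (dX N) 1 := by
        rw [h1]
        exact ⟨a, b, hab, rfl⟩
      exact ⟨_, ⟨this.1, this.2.le⟩, hf⟩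

/-- A partition whose point lies on a segment between two partitions is one of the endpoints. -/
theorem eq_or_eq_of_mem_segment (hN : 2 ≤ N) {a b c : YN N}
    (h : hullPoint c ∈ segment ℝ (hullPoint a) (hullPoint b)) : c = a ∨ c = b := by
  by_cases hca : c = a
  · exact Or.inl hca
  by_cases hcb : c = b
  · exact Or.inr hcb
  exfalso
  have hinj := hullPoint_injective hN
  obtain ⟨s, t, hs, ht, hst, hc⟩ := mem_openSegment_of_ne_left_right
    (fun h => hca (hinj h.symm)) (fun h => hcb (hinj h.symm)) h
  have hmem : ∀ {x y}, hullPoint c x + hullPoint c y = dX N x y →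
      hullPoint a x + hullPoint a y = dX N x y ∧ hullPoint b x + hullPoint b y = dX N x y := by
    intro x y hxy
    rw [← hc] at hxy
    exact (midpoint_tight (hullPoint_mem_polyhedron a) (hullPoint_mem_polyhedron b)
      hs ht hst).1 hxy
  have ha : hullPoint a ∈ tightFace (dX N) (hullPoint c) :=
    ⟨hullPoint_mem_polyhedron a, fun x y hxy => (hmem hxy).1⟩
  rw [tightFace_hullPoint hN] at ha
  exact hca (hinj ha).symm

/-- The endpoints of an edge through an interior point of another edge belong to that edge. -/
theorem mem_segment_of_mem_openSegment (hN : 2 ≤ N) {a b a' b' : YN N} {f : XN N → ℝ}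
    (h : (hasseYN N).Adj a b) (hf : f ∈ segment ℝ (hullPoint a) (hullPoint b))
    (hf' : f ∈ openSegment ℝ (hullPoint a') (hullPoint b')) :
    hullPoint a' ∈ segment ℝ (hullPoint a) (hullPoint b) ∧
      hullPoint b' ∈ segment ℝ (hullPoint a) (hullPoint b) := by
  obtain ⟨s, t, hs, ht, hst, rfl⟩ := hf'
  rw [← tightFace_edgeMid hN h] at hf ⊢
  have key := fun x y hxy => (midpoint_tight (hullPoint_mem_polyhedron a')
    (hullPoint_mem_polyhedron b') hs ht hst).1 (hf.2 x y hxy)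
  exact ⟨⟨hullPoint_mem_polyhedron a', fun x y hxy => (key x y hxy).1⟩,
    ⟨hullPoint_mem_polyhedron b', fun x y hxy => (key x y hxy).2⟩⟩

theorem isGeometricRealization_hullPoint (hN : 2 ≤ N) :
    IsGeometricRealization (hasseYN N) (hullPoint (N := N)) (oneSkeleton (dX N)) where
  injective := hullPoint_injective hN
  carrier := oneSkeleton_eq hN
  vertex_edge _ _ _ _ h := eq_or_eq_of_mem_segment hN h
  edge_edge := by
    rintro a b a' b' hab hab' hne f ⟨hf, hf'⟩
    by_cases h1 : hullPoint a' = f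
    · subst h1
      exact ⟨a', ⟨by simpa using eq_or_eq_of_mem_segment hN hf, by simp⟩, rfl⟩
    by_cases h2 : hullPoint b' = f
    · subst h2
      exact ⟨b', ⟨by simpa using eq_or_eq_of_mem_segment hN hf, by simp⟩, rfl⟩
    exfalso
    -- The common point is now interior to the second edge, so the first edge, being a face,
    -- contains both of its endpoints and the edges agree.
    obtain ⟨h3, h4⟩ := mem_segment_of_mem_openSegment hN hab hf
      (mem_openSegment_of_ne_left_right h1 h2 hf')
    have hne' := hab'.ne
    apply hne
    rw [Sym2.eq_iff]
    rcases eq_or_eq_of_mem_segment hN h3 with rfl | rfl <;>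
      rcases eq_or_eq_of_mem_segment hN h4 with rfl | rfl <;> simp_all

end Skeleton

end YoungHull

theorem theorem1p4 (N : ℕ) (hN : 2 ≤ N) :
    -- the boundary consists of `N` points: the empty partition and the rectangles `(j^(N-j))`
    (∀ μ : YoungHull.YN N, μ ∈ YoungHull.pendantVertices (YoungHull.hasseYN N) ↔
      μ.1 = ⊥ ∨ ∃ j : ℕ, 1 ≤ j ∧ j ≤ N - 1 ∧ μ.1 = YoungHull.rect (N - j) j) ∧
    Fintype.card (YoungHull.XN N) = N ∧
    -- the `1`-skeleton of the injective hull realizes the Hasse graph, with edges of length one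
    ∃ p : YoungHull.YN N → (YoungHull.XN N → ℝ),
      YoungHull.IsGeometricRealization (YoungHull.hasseYN N) p
        (YoungHull.oneSkeleton (YoungHull.dX N)) ∧
      YoungHull.hullFacesOfDim (YoungHull.dX N) 0 = {F | ∃ a, F = {p a}} ∧
      YoungHull.hullFacesOfDim (YoungHull.dX N) 1 =
        {F | ∃ a b, (YoungHull.hasseYN N).Adj a b ∧ F = segment ℝ (p a) (p b)} ∧
      (∀ a b, (YoungHull.hasseYN N).Adj a b → dist (p a) (p b) = 1) := by
  exact ⟨YoungHull.mem_pendantVertices_iff hN, YoungHull.card_XN hN, YoungHull.hullPoint,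
    YoungHull.isGeometricRealization_hullPoint hN, YoungHull.hullFacesOfDim_zero hN,
    YoungHull.hullFacesOfDim_one hN, fun _ _ h => YoungHull.dist_hullPoint_of_adj hN h⟩
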